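/- **Setting.** Let $\mathcal X_1,\mathcal X_2,\mathcal V_1,\mathcal V_2,\mathcal Y_1,\mathcal Y_2$ be finite alphabets. A two-user El Gamal–Costa deterministic interference channel is given by functions with $V_1=g_1(X_1)$, $V_2=g_2(X_2)$, $Y_1=f_1(X_1,V_2)$, $Y_2=f_2(X_2,V_1)$ such that $H(V_2|Y_1,X_1)=0$ and $H(V_1|Y_2,X_2)=0$ for every joint distribution of the inputs $(X_1,X_2)$. Let $C_{FB1},C_{FB2}\ge 0$. A code of block length $N$ and rates $R_1,R_2\ge 0$ has independent, uniformly distributed messages $W_k\in\{1,\dots,\lfloor 2^{NR_k}\rfloor\}$, feedback encoders $\tilde Y_{k,i}=\tilde e_{k,i}(Y_{k,1},\dots,Y_{k,i-1})$, channel encoders $X_{k,i}=e_{k,i}(W_k,\tilde Y_{k,1},\dots,\tilde Y_{k,i-1})$ and decoders $\hat W_k=d_k(Y_{k,1},\dots,Y_{k,N})$, $k=1,2$, where the feedback alphabets satisfy the rate limit $\prod_{i=1}^N|\tilde{\mathcal Y}_{k,i}|\le 2^{NC_{FBk}}$. A pair $(R_1,R_2)$ is achievable if there are codes of these rates, one for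 each $N$, with $P(\hat W_1\ne W_1)\to0$ and $P(\hat W_2\ne W_2)\to 0$ as $N\to\infty$; the capacity region is the closure of the set of achievable pairs. Entropies are in bits. **Theorem.** The capacity region is contained in the set $\bar{\mathcal C}$ of all $(R_1,R_2)$ for which there exist random variables $U_1,U_2$ with finite alphabets and a joint distribution $p(u_1,u_2)\,p(x_1|u_1,u_2)\,p(x_2|u_1,u_2)$ such that $$\begin{aligned} R_1&\le\min\{H(Y_1),\;H(Y_1|V_1,V_2,U_1)+H(Y_2|X_2,U_1)\},\\ R_1&\le H(Y_1|X_2,U_1)+C_{FB2},\\ R_2&\le\min\{H(Y_2),\;H(Y_2|V_1,V_2,U_2)+H(Y_1|X_1,U_2)\},\\ R_2&\le H(Y_2|X_1,U_2)+C_{FB1},\\ R_1+R_2&\le H(Y_1|V_1,V_2,U_1)+H(Y_2),\\ R_1+R_2&\le H(Y_2|V_1,V_2,U_2)+H(Y_1),\\ R_1+R_2&\le H(Y_1|V_1)+H(Y_2|V_2)+C_{FB1}+C_{FB2},\\ 2R_1+R_2&\le H(Y_1)+H(Y_1|V_1,V_2,U_1)+H(Y_2|V_2)+C_{FB2},\\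 R_1+2R_2&\le H(Y_2)+H(Y_2|V_1,V_2,U_2)+H(Y_1|V_1)+C_{FB1}. \end{aligned}$$ -/

import Mathlib

noncomputable section

namespace FeedbackIC

/-! ### Shannon entropy of finite-valued random variables, in bits -/

section Entropy

variable {Ω A B : Type*} [Fintype A] [Fintype B]

/-- `P(X = a)` for a random variable `X` on the discrete probability space `(Ω, p)`. -/
def prob {A : Type*} (p : PMF Ω) (X : Ω → A) (a : A) : ℝ :=
  (p.map X a).toReal

/-- The entropy `H(X) = - ∑ P(X = a) log₂ P(X = a)`. -/
def entropy (p : PMF Ω) (X : Ω → A) : ℝ :=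
  - ∑ a, prob p X a * Real.logb 2 (prob p X a)

/-- The conditional entropy
`H(X | Z) = - ∑ P(X = a, Z = b) log₂ (P(X = a, Z = b) / P(Z = b))`. -/
def condEntropy (p : PMF Ω) (X : Ω → A) (Z : Ω → B) : ℝ :=
  - ∑ a, ∑ b, prob p (fun ω => (X ω, Z ω)) (a, b) *
      Real.logb 2 (prob p (fun ω => (X ω, Z ω)) (a, b) / prob p Z b)

end Entropy

/-! ### The deterministic interference channel -/

/-- A two-user deterministic interference channel:
`V₁ = g₁(X₁)`, `V₂ = g₂(X₂)`, `Y₁ = f₁(X₁, V₂)`, `Y₂ = f₂(X₂, V₁)`. -/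
structure DetIC (X₁ X₂ V₁ V₂ Y₁ Y₂ : Type*) where
  g₁ : X₁ → V₁
  g₂ : X₂ → V₂
  f₁ : X₁ → V₂ → Y₁
  f₂ : X₂ → V₁ → Y₂

variable {X₁ X₂ V₁ V₂ Y₁ Y₂ : Type*}

/-- The output at receiver 1 as a function of the two inputs. -/
def DetIC.out₁ (ch : DetIC X₁ X₂ V₁ V₂ Y₁ Y₂) (x₁ : X₁) (x₂ : X₂) : Y₁ :=
  ch.f₁ x₁ (ch.g₂ x₂)

/-- The output at receiver 2 as a function of the two inputs. -/
def DetIC.out₂ (ch : DetIC X₁ X₂ V₁ V₂ Y₁ Y₂) (x₁ : X₁) (x₂ : X₂) : Y₂ :=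
  ch.f₂ x₂ (ch.g₁ x₁)

/-- The El Gamal–Costa condition: `H(V₂ | Y₁, X₁) = 0` and `H(V₁ | Y₂, X₂) = 0`, whatever the
joint distribution of the inputs `(X₁, X₂)`. -/
def DetIC.IsElGamalCosta [Fintype X₁] [Fintype X₂] [Fintype V₁] [Fintype V₂] [Fintype Y₁]
    [Fintype Y₂] (ch : DetIC X₁ X₂ V₁ V₂ Y₁ Y₂) : Prop :=
  ∀ p : PMF (X₁ × X₂),
    condEntropy p (fun x => ch.g₂ x.2) (fun x => (ch.out₁ x.1 x.2, x.1)) = 0 ∧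
    condEntropy p (fun x => ch.g₁ x.1) (fun x => (ch.out₂ x.1 x.2, x.2)) = 0

/-! ### Block codes with rate-limited feedback -/

/-- A block code of length `N` for message sets of sizes `M₁`, `M₂` and noiseless feedback links of
capacities `C₁`, `C₂` (bits per channel use). At time `i` the feedback encoder at receiver `k`
produces a symbol from an alphabet of size `mₖ i` as a function of the outputs received strictly
before time `i`, and transmitter `k` sends a function of its message and of the feedback symbols of
the times strictly before `i`. Over the whole block the feedback link `k` can convey at most
`2 ^ (N Cₖ)` different sequences. -/
structure Code (X₁ X₂ Y₁ Y₂ : Type*) (C₁ C₂ : ℝ) (N M₁ M₂ : ℕ) where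
  m₁ : Fin N → ℕ
  m₂ : Fin N → ℕ
  fb₁ : (i : Fin N) → (Set.Iio i → Y₁) → Fin (m₁ i)
  fb₂ : (i : Fin N) → (Set.Iio i → Y₂) → Fin (m₂ i)
  enc₁ : (i : Fin N) → Fin M₁ → ((j : Set.Iio i) → Fin (m₁ j)) → X₁
  enc₂ : (i : Fin N) → Fin M₂ → ((j : Set.Iio i) → Fin (m₂ j)) → X₂
  dec₁ : (Fin N → Y₁) → Fin M₁
  dec₂ : (Fin N → Y₂) → Fin M₂
  rate₁ : (∏ i, (m₁ i : ℝ)) ≤ (2 : ℝ) ^ ((N : ℝ) * C₁)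
  rate₂ : (∏ i, (m₂ i : ℝ)) ≤ (2 : ℝ) ^ ((N : ℝ) * C₂)

namespace Code

variable {C₁ C₂ : ℝ} {N M₁ M₂ : ℕ}

/-- The pair of channel outputs at time `i` when the messages are `w = (w₁, w₂)`. -/
def output (c : Code X₁ X₂ Y₁ Y₂ C₁ C₂ N M₁ M₂) (ch : DetIC X₁ X₂ V₁ V₂ Y₁ Y₂)
    (w : Fin M₁ × Fin M₂) (i : Fin N) : Y₁ × Y₂ :=
  let x₁ : X₁ := c.enc₁ i w.1 fun j => c.fb₁ j.1 fun l => (c.output ch w l.1).1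
  let x₂ : X₂ := c.enc₂ i w.2 fun j => c.fb₂ j.1 fun l => (c.output ch w l.1).2
  (ch.out₁ x₁ x₂, ch.out₂ x₁ x₂)
termination_by i.val
decreasing_by
  all_goals
    have h1 : l.1 < j.1 := l.2
    have h2 : j.1 < i := j.2
    exact lt_trans h1 h2

/-- The probability that receiver 1 decodes its message wrongly, for independent and uniformly
distributed messages. -/
def err₁ (c : Code X₁ X₂ Y₁ Y₂ C₁ C₂ N M₁ M₂) (ch : DetIC X₁ X₂ V₁ V₂ Y₁ Y₂) : ℝ :=
  ((Finset.univ.filter fun w : Fin M₁ × Fin M₂ =>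
    c.dec₁ (fun i => (c.output ch w i).1) ≠ w.1).card : ℝ) / ((M₁ : ℝ) * (M₂ : ℝ))

/-- The probability that receiver 2 decodes its message wrongly, for independent and uniformly
distributed messages. -/
def err₂ (c : Code X₁ X₂ Y₁ Y₂ C₁ C₂ N M₁ M₂) (ch : DetIC X₁ X₂ V₁ V₂ Y₁ Y₂) : ℝ :=
  ((Finset.univ.filter fun w : Fin M₁ × Fin M₂ =>
    c.dec₂ (fun i => (c.output ch w i).2) ≠ w.2).card : ℝ) / ((M₁ : ℝ) * (M₂ : ℝ))

end Code

/-! ### Achievable rates and the capacity region -/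

/-- The number of messages `w` with `1 ≤ w ≤ 2 ^ (N R)`. -/
def numMessages (N : ℕ) (R : ℝ) : ℕ :=
  ⌊(2 : ℝ) ^ ((N : ℝ) * R)⌋₊

/-- `(R₁, R₂)` is achievable: there is a sequence of block codes of these rates for which both
average error probabilities tend to zero. -/
def Achievable (ch : DetIC X₁ X₂ V₁ V₂ Y₁ Y₂) (C₁ C₂ : ℝ) (R : ℝ × ℝ) : Prop :=
  0 ≤ R.1 ∧ 0 ≤ R.2 ∧
    ∃ c : (N : ℕ) → Code X₁ X₂ Y₁ Y₂ C₁ C₂ N (numMessages N R.1) (numMessages N R.2),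
      Filter.Tendsto (fun N => (c N).err₁ ch) Filter.atTop (nhds 0) ∧
      Filter.Tendsto (fun N => (c N).err₂ ch) Filter.atTop (nhds 0)

/-- The capacity region: the closure of the set of achievable rate pairs. -/
def capacityRegion (ch : DetIC X₁ X₂ V₁ V₂ Y₁ Y₂) (C₁ C₂ : ℝ) : Set (ℝ × ℝ) :=
  closure {R | Achievable ch C₁ C₂ R}

/-! ### The outer region -/

/-- The law `p(u₁, u₂) p(x₁ | u₁, u₂) p(x₂ | u₁, u₂)` of `((U₁, U₂), (X₁, X₂))`. -/
def jointLaw {U₁ U₂ : Type*} (pU : PMF (U₁ × U₂)) (k₁ : U₁ × U₂ → PMF X₁)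
    (k₂ : U₁ × U₂ → PMF X₂) : PMF ((U₁ × U₂) × (X₁ × X₂)) :=
  pU.bind fun u => (k₁ u).bind fun x₁ => (k₂ u).map fun x₂ => (u, (x₁, x₂))

/-- The rate pairs that satisfy all the entropy bounds for a given law `p` of
`((U₁, U₂), (X₁, X₂))`. -/
def boundsFor [Fintype X₁] [Fintype X₂] [Fintype V₁] [Fintype V₂] [Fintype Y₁] [Fintype Y₂]
    {U₁ U₂ : Type*} [Fintype U₁] [Fintype U₂]
    (ch : DetIC X₁ X₂ V₁ V₂ Y₁ Y₂) (C₁ C₂ : ℝ) (p : PMF ((U₁ × U₂) × (X₁ × X₂))) :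
    Set (ℝ × ℝ) :=
  let U1 : (U₁ × U₂) × (X₁ × X₂) → U₁ := fun ω => ω.1.1
  let U2 : (U₁ × U₂) × (X₁ × X₂) → U₂ := fun ω => ω.1.2
  let X1 : (U₁ × U₂) × (X₁ × X₂) → X₁ := fun ω => ω.2.1
  let X2 : (U₁ × U₂) × (X₁ × X₂) → X₂ := fun ω => ω.2.2
  let V1 : (U₁ × U₂) × (X₁ × X₂) → V₁ := fun ω => ch.g₁ (X1 ω)
  let V2 : (U₁ × U₂) × (X₁ × X₂) → V₂ := fun ω => ch.g₂ (X2 ω)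
  let Y1 : (U₁ × U₂) × (X₁ × X₂) → Y₁ := fun ω => ch.f₁ (X1 ω) (V2 ω)
  let Y2 : (U₁ × U₂) × (X₁ × X₂) → Y₂ := fun ω => ch.f₂ (X2 ω) (V1 ω)
  {R | R.1 ≤ min (entropy p Y1)
          (condEntropy p Y1 (fun ω => (V1 ω, V2 ω, U1 ω)) +
            condEntropy p Y2 (fun ω => (X2 ω, U1 ω))) ∧
    R.1 ≤ condEntropy p Y1 (fun ω => (X2 ω, U1 ω)) + C₂ ∧
    R.2 ≤ min (entropy p Y2)
          (condEntropy p Y2 (fun ω => (V1 ω, V2 ω, U2 ω)) +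
            condEntropy p Y1 (fun ω => (X1 ω, U2 ω))) ∧
    R.2 ≤ condEntropy p Y2 (fun ω => (X1 ω, U2 ω)) + C₁ ∧
    R.1 + R.2 ≤ condEntropy p Y1 (fun ω => (V1 ω, V2 ω, U1 ω)) + entropy p Y2 ∧
    R.1 + R.2 ≤ condEntropy p Y2 (fun ω => (V1 ω, V2 ω, U2 ω)) + entropy p Y1 ∧
    R.1 + R.2 ≤ condEntropy p Y1 V1 + condEntropy p Y2 V2 + C₁ + C₂ ∧
    2 * R.1 + R.2 ≤ entropy p Y1 + condEntropy p Y1 (fun ω => (V1 ω, V2 ω, U1 ω)) +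
      condEntropy p Y2 V2 + C₂ ∧
    R.1 + 2 * R.2 ≤ entropy p Y2 + condEntropy p Y2 (fun ω => (V1 ω, V2 ω, U2 ω)) +
      condEntropy p Y1 V1 + C₁}

/-- The outer region: the rate pairs that satisfy all the bounds for some law of the form
`p(u₁, u₂) p(x₁ | u₁, u₂) p(x₂ | u₁, u₂)`, where `U₁` and `U₂` have arbitrary finite alphabets. -/
def outerRegion [Fintype X₁] [Fintype X₂] [Fintype V₁] [Fintype V₂] [Fintype Y₁] [Fintype Y₂]
    (ch : DetIC X₁ X₂ V₁ V₂ Y₁ Y₂) (C₁ C₂ : ℝ) : Set (ℝ × ℝ) :=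
  {R | ∃ (n₁ n₂ : ℕ) (pU : PMF (Fin n₁ × Fin n₂)) (k₁ : Fin n₁ × Fin n₂ → PMF X₁)
      (k₂ : Fin n₁ × Fin n₂ → PMF X₂), R ∈ boundsFor ch C₁ C₂ (jointLaw pU k₁ k₂)}

end FeedbackIC

end

/-! Run a code with uniform messages, draw a time uniformly and independently of them, and let U₁
consist of the time and the past of V₂, U₂ of the time and the past of V₁. Write Sₖ for the feedback
sequence of link k; its entropy is at most N times the capacity of the link.

The block inequalities rest on Fano's inequality, the independence of the messages and two
determinations: (Y₁, W₁) determines V₂ by causality and the El Gamal–Costa condition, and (S₂, W₂)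
determines X₂. By submodularity the second gives H(V₂) ≤ H(V₂|W₁) + H(S₂) (`entropy_v₂_le`), and the
first bounds H(V₂|W₁) by H(Y₁|W₁). The nine bounds are linear combinations in which H(Y₁|W₁) and
H(Y₂|W₂) cancel or are dropped as nonnegative (`Transmission.mem_boundsFor`). The chain rule and
concavity of conditional entropy make them single-letter (`condEntropy_le_card_mul`).

Given (U₁, U₂), the message pairs compatible with given pasts of V₁ and V₂ form a rectangle:
swapping W₂ between two of them changes neither the pasts nor the dependence of each input on its
own message. Hence X₁ and X₂ are conditionally independent (`exchange`,
`prob_mul_prob_of_exchange`).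

The rates obtained only converge to (R₁, R₂), while the alphabets of U₁, U₂ grow with N, so the
outer region must be shown closed. No bound conditions on U₁ and U₂ together. Constant auxiliaries
therefore give the weakest bounds, and a one-time pad attains them for every input law: a key and
the encrypted inputs are each independent of the inputs but jointly determine them. The region is
thus a projection along the compact simplex of input laws (`isClosed_outerRegion`). -/

namespace FeedbackIC

/-! ### Entropy calculus on a finite probability space -/

section Entropy

variable {Ω Ω' A B C : Type*}

theorem prob_nonneg (p : PMF Ω) (X : Ω → A) (a : A) : 0 ≤ prob p X a :=
  ENNReal.toReal_nonneg

theorem prob_map (p : PMF Ω) (F : Ω → Ω') (X : Ω' → A) :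
    prob (p.map F) X = prob p (fun ω => X (F ω)) := by
  funext a
  simp only [prob, PMF.map_comp]
  rfl

theorem entropy_map [Fintype A] (p : PMF Ω) (F : Ω → Ω') (X : Ω' → A) :
    entropy (p.map F) X = entropy p (fun ω => X (F ω)) := by
  simp only [entropy, prob_map]

theorem condEntropy_map [Fintype A] [Fintype B] (p : PMF Ω) (F : Ω → Ω') (X : Ω' → A)
    (Z : Ω' → B) :
    condEntropy (p.map F) X Z = condEntropy p (fun ω => X (F ω)) (fun ω => Z (F ω)) := by
  simp only [condEntropy, prob_map]

variable [Fintype Ω]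

open Classical in
theorem prob_eq_sum (p : PMF Ω) (X : Ω → A) (a : A) :
    prob p X a = ∑ ω, if X ω = a then (p ω).toReal else 0 := by
  rw [prob, PMF.map_apply, tsum_fintype, ENNReal.toReal_sum]
  · refine Finset.sum_congr rfl fun ω _ => ?_
    by_cases h : X ω = a
    · simp [h]
    · simp [h, Ne.symm h]
  · intro ω _
    split_ifs
    · exact p.apply_ne_top ω
    · simp

theorem sum_toReal (p : PMF Ω) : ∑ ω, (p ω).toReal = 1 := by
  rw [← ENNReal.toReal_sum fun ω _ => p.apply_ne_top ω, ← tsum_fintype (L := .unconditional Ω),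
    p.tsum_coe, ENNReal.toReal_one]

theorem sum_prob_mul [Fintype A] (p : PMF Ω) (X : Ω → A) (f : A → ℝ) :
    ∑ a, prob p X a * f a = ∑ ω, (p ω).toReal * f (X ω) := by
  classical
  simp_rw [prob_eq_sum, Finset.sum_mul]
  rw [Finset.sum_comm]
  simp [ite_mul]

theorem sum_prob [Fintype A] (p : PMF Ω) (X : Ω → A) : ∑ a, prob p X a = 1 := by
  simpa [sum_toReal] using sum_prob_mul p X fun _ => 1

theorem toReal_le_prob (p : PMF Ω) (X : Ω → A) (ω : Ω) : (p ω).toReal ≤ prob p X (X ω) := by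
  classical
  rw [prob_eq_sum]
  have := Finset.single_le_sum (f := fun ω' => if X ω' = X ω then (p ω').toReal else 0)
    (fun ω' _ => by split_ifs <;> simp) (Finset.mem_univ ω)
  simpa using this

theorem prob_le_prob (p : PMF Ω) {X : Ω → A} {Z : Ω → B} (h : X.FactorsThrough Z) (ω : Ω) :
    prob p Z (Z ω) ≤ prob p X (X ω) := by
  classical
  simp only [prob_eq_sum]
  refine Finset.sum_le_sum fun ω' _ => ?_
  by_cases h' : Z ω' = Z ω
  · rw [if_pos h', if_pos (h h')]
  · rw [if_neg h']
    split_ifs <;> simp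

/-- As an expectation over `Ω`, entropies of variables with different alphabets can be compared term
by term. -/
theorem entropy_eq_sum [Fintype A] (p : PMF Ω) (X : Ω → A) :
    entropy p X = - ∑ ω, (p ω).toReal * Real.logb 2 (prob p X (X ω)) := by
  rw [entropy, sum_prob_mul p X fun a => Real.logb 2 (prob p X a)]

theorem condEntropy_eq_sum [Fintype A] [Fintype B] (p : PMF Ω) (X : Ω → A) (Z : Ω → B) :
    condEntropy p X Z = - ∑ ω, (p ω).toReal *
      Real.logb 2 (prob p (fun ω => (X ω, Z ω)) (X ω, Z ω) / prob p Z (Z ω)) := by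
  rw [condEntropy, ← sum_prob_mul p (fun ω => (X ω, Z ω)) fun c =>
    Real.logb 2 (prob p (fun ω => (X ω, Z ω)) c / prob p Z c.2), Fintype.sum_prod_type]

/-- The chain rule. -/
theorem condEntropy_eq_sub [Fintype A] [Fintype B] (p : PMF Ω) (X : Ω → A) (Z : Ω → B) :
    condEntropy p X Z = entropy p (fun ω => (X ω, Z ω)) - entropy p Z := by
  rw [condEntropy_eq_sum, entropy_eq_sum, entropy_eq_sum, neg_sub_neg, ← Finset.sum_sub_distrib,
    ← Finset.sum_neg_distrib]
  refine Finset.sum_congr rfl fun ω _ => ?_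
  rcases (ENNReal.toReal_nonneg (a := p ω)).eq_or_lt with h | h
  · simp [← h]
  · rw [Real.logb_div (h.trans_le (toReal_le_prob p (fun ω => (X ω, Z ω)) ω)).ne'
      (h.trans_le (toReal_le_prob p Z ω)).ne']
    ring

/-- Each fibre of `Z` lies in a fibre of `X`, so `X` takes its value with the larger probability.
`FactorsThrough` expresses throughout that one variable is determined by another. -/
theorem entropy_le_of_factorsThrough [Fintype A] [Fintype B] (p : PMF Ω) {X : Ω → A} {Z : Ω → B}
    (h : X.FactorsThrough Z) : entropy p X ≤ entropy p Z := by
  rw [entropy_eq_sum, entropy_eq_sum, neg_le_neg_iff]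
  refine Finset.sum_le_sum fun ω _ => ?_
  rcases (ENNReal.toReal_nonneg (a := p ω)).eq_or_lt with h0 | h0
  · simp [← h0]
  · exact mul_le_mul_of_nonneg_left (Real.logb_le_logb_of_le one_lt_two
      (h0.trans_le (toReal_le_prob p Z ω)) (prob_le_prob p h ω)) h0.le

theorem entropy_congr [Fintype A] [Fintype B] (p : PMF Ω) {X : Ω → A} {Z : Ω → B}
    (h : X.FactorsThrough Z) (h' : Z.FactorsThrough X) : entropy p X = entropy p Z :=
  le_antisymm (entropy_le_of_factorsThrough p h) (entropy_le_of_factorsThrough p h')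

theorem condEntropy_nonneg [Fintype A] [Fintype B] (p : PMF Ω) (X : Ω → A) (Z : Ω → B) :
    0 ≤ condEntropy p X Z := by
  rw [condEntropy_eq_sub, sub_nonneg]
  exact entropy_le_of_factorsThrough p fun ω ω' h => congrArg Prod.snd h

/-- Gibbs' inequality: replacing the conditional law of `X` given `Z` by a subprobability kernel `q`
inside the logarithm does not decrease the conditional entropy. -/
theorem condEntropy_le_crossEntropy [Fintype A] [Fintype B] (p : PMF Ω) (X : Ω → A) (Z : Ω → B)
    (q : A → B → ℝ) (hq : ∀ a b, 0 ≤ q a b) (hsum : ∀ b, ∑ a, q a b ≤ 1)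
    (hpos : ∀ ω, 0 < (p ω).toReal → 0 < q (X ω) (Z ω)) :
    condEntropy p X Z ≤ - ∑ ω, (p ω).toReal * Real.logb 2 (q (X ω) (Z ω)) := by
  set P : A × B → ℝ := prob p (fun ω => (X ω, Z ω)) with hP
  -- The likelihood ratio of `q` to the true conditional law has mean at most 1; the claim then
  -- follows from log t ≤ t - 1.
  have key : ∑ ω, (p ω).toReal * (prob p Z (Z ω) * q (X ω) (Z ω) / P (X ω, Z ω)) ≤ 1 := by
    rw [← sum_prob_mul p (fun ω => (X ω, Z ω)) fun c => prob p Z c.2 * q c.1 c.2 / P c]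
    calc ∑ c, P c * (prob p Z c.2 * q c.1 c.2 / P c)
        ≤ ∑ c : A × B, prob p Z c.2 * q c.1 c.2 := by
          refine Finset.sum_le_sum fun c _ => ?_
          rcases (prob_nonneg p (fun ω => (X ω, Z ω)) c).eq_or_lt with h | h
          · rw [hP, ← h, zero_mul]
            exact mul_nonneg (prob_nonneg _ _ _) (hq _ _)
          · rw [mul_div_cancel₀ _ h.ne']
      _ = ∑ b, prob p Z b * ∑ a, q a b := by
          rw [Fintype.sum_prod_type_right]
          simp_rw [Finset.mul_sum]
      _ ≤ ∑ b, prob p Z b * 1 :=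
          Finset.sum_le_sum fun b _ => mul_le_mul_of_nonneg_left (hsum b) (prob_nonneg _ _ _)
      _ = 1 := by simp [sum_prob]
  have hlog : 0 < Real.log 2 := Real.log_pos one_lt_two
  have term : ∀ ω, (p ω).toReal * Real.logb 2 (q (X ω) (Z ω)) -
      (p ω).toReal * Real.logb 2 (P (X ω, Z ω) / prob p Z (Z ω)) ≤
      ((p ω).toReal * (prob p Z (Z ω) * q (X ω) (Z ω) / P (X ω, Z ω)) - (p ω).toReal) /
        Real.log 2 := by
    intro ω
    rcases (ENNReal.toReal_nonneg (a := p ω)).eq_or_lt with h0 | h0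
    · simp [← h0]
    have h1 : 0 < P (X ω, Z ω) := h0.trans_le (toReal_le_prob p (fun ω => (X ω, Z ω)) ω)
    have h2 : 0 < prob p Z (Z ω) := h0.trans_le (toReal_le_prob p Z ω)
    have h3 := hpos ω h0
    have h4 := Real.log_le_sub_one_of_pos
      (show 0 < prob p Z (Z ω) * q (X ω) (Z ω) / P (X ω, Z ω) by positivity)
    rw [← mul_sub, ← Real.logb_div h3.ne' (by positivity), Real.logb, mul_div_assoc']
    refine div_le_div_of_nonneg_right ?_ hlog.le
    rw [show q (X ω) (Z ω) / (P (X ω, Z ω) / prob p Z (Z ω)) =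
      prob p Z (Z ω) * q (X ω) (Z ω) / P (X ω, Z ω) by field_simp]
    nlinarith
  have := Finset.sum_le_sum fun ω (_ : ω ∈ Finset.univ) => term ω
  rw [Finset.sum_sub_distrib, ← Finset.sum_div, Finset.sum_sub_distrib, sum_toReal] at this
  have h5 := this.trans (div_nonpos_of_nonpos_of_nonneg (sub_nonpos.2 key) hlog.le)
  rw [condEntropy_eq_sum]
  linarith

theorem prob_pair_sum [Fintype A] (p : PMF Ω) (X : Ω → A) (Z : Ω → B) (b : B) :
    ∑ a, prob p (fun ω => (X ω, Z ω)) (a, b) = prob p Z b := by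
  classical
  simp only [prob_eq_sum, Prod.mk.injEq]
  rw [Finset.sum_comm]
  refine Finset.sum_congr rfl fun ω _ => ?_
  by_cases h : Z ω = b <;> simp [h]

/-- Conditional entropy is concave in the law: if `q` is a uniform mixture, over `i`, of copies of
`p`, then the average of the conditional entropies is at most the conditional entropy of the
mixture. -/
theorem sum_condEntropy_le_of_mixture {ι : Type*} [Fintype ι] [Fintype A] [Fintype B] (p : PMF Ω)
    (q : PMF (ι × Ω))
    (hq : ∀ i ω, (Fintype.card ι : ℝ) * (q (i, ω)).toReal = (p ω).toReal) (X : ι × Ω → A)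
    (Z : ι × Ω → B) :
    ∑ i, condEntropy p (fun ω => X (i, ω)) (fun ω => Z (i, ω)) ≤
      Fintype.card ι * condEntropy q X Z := by
  set P : A × B → ℝ := prob q (fun ω => (X ω, Z ω)) with hP
  have hle : ∀ i, condEntropy p (fun ω => X (i, ω)) (fun ω => Z (i, ω)) ≤
      - ∑ ω, (p ω).toReal * Real.logb 2 (P (X (i, ω), Z (i, ω)) / prob q Z (Z (i, ω))) := by
    intro i
    -- Every component is compared with one kernel, the conditional law under the mixture; the cross
    -- entropies then average exactly to the conditional entropy of the mixture.
    refine condEntropy_le_crossEntropy p _ _ (fun a b => P (a, b) / prob q Z b)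
      (fun a b => div_nonneg (prob_nonneg _ _ _) (prob_nonneg _ _ _)) (fun b => ?_) fun ω h => ?_
    · rw [← Finset.sum_div, hP, prob_pair_sum]
      exact div_self_le_one _
    · have h0 : 0 < (q (i, ω)).toReal := by
        rw [← hq i ω] at h
        exact (pos_iff_pos_of_mul_pos h).1
          (Nat.cast_pos.2 (Fintype.card_pos_iff.2 ⟨i⟩))
      exact div_pos (h0.trans_le (toReal_le_prob q (fun ω => (X ω, Z ω)) (i, ω)))
        (h0.trans_le (toReal_le_prob q Z (i, ω)))
  refine (Finset.sum_le_sum fun i _ => hle i).trans_eq ?_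
  rw [condEntropy_eq_sum, Finset.sum_neg_distrib, Fintype.sum_prod_type, mul_neg, Finset.mul_sum]
  simp_rw [Finset.mul_sum, ← mul_assoc, hq]
  rfl

/-- Conditioning reduces entropy. -/
theorem condEntropy_le_of_factorsThrough [Fintype A] [Fintype B] [Fintype C] (p : PMF Ω) (X : Ω → A)
    {Z : Ω → B} {Z' : Ω → C} (h : Z.FactorsThrough Z') :
    condEntropy p X Z' ≤ condEntropy p X Z := by
  -- Adjoining `Z` to `Z'` adds no information, but lets the comparison kernel, the law of `X` given
  -- `Z`, be read off the conditioning variable.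
  have h1 : condEntropy p X Z' = condEntropy p X (fun ω => (Z ω, Z' ω)) := by
    rw [condEntropy_eq_sub, condEntropy_eq_sub]
    congr 1 <;> refine entropy_congr p ?_ ?_ <;> intro ω ω' hω <;> simp_all only [Prod.mk.injEq]
    · exact ⟨trivial, h hω.2, trivial⟩
    · exact ⟨h hω, trivial⟩
  rw [h1, condEntropy_eq_sum p X Z]
  refine condEntropy_le_crossEntropy p X (fun ω => (Z ω, Z' ω))
    (fun a b => prob p (fun ω => (X ω, Z ω)) (a, b.1) / prob p Z b.1)
    (fun a b => div_nonneg (prob_nonneg _ _ _) (prob_nonneg _ _ _)) (fun b => ?_) fun ω h0 => ?_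
  · rw [← Finset.sum_div, prob_pair_sum]
    exact div_self_le_one _
  · exact div_pos (h0.trans_le (toReal_le_prob p (fun ω => (X ω, Z ω)) ω))
      (h0.trans_le (toReal_le_prob p Z ω))

theorem condEntropy_congr [Fintype A] [Fintype B] [Fintype C] (p : PMF Ω) (X : Ω → A)
    {Z : Ω → B} {Z' : Ω → C} (h : Z.FactorsThrough Z') (h' : Z'.FactorsThrough Z) :
    condEntropy p X Z' = condEntropy p X Z :=
  le_antisymm (condEntropy_le_of_factorsThrough p X h) (condEntropy_le_of_factorsThrough p X h')

theorem condEntropy_const [Fintype A] [Fintype B] (p : PMF Ω) (X : Ω → A) (b : B) :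
    condEntropy p X (fun _ => b) = entropy p X := by
  have h : entropy p (fun _ : Ω => b) = 0 := by
    classical
    have : prob p (fun _ : Ω => b) b = 1 := by simp [prob_eq_sum, sum_toReal]
    simp [entropy_eq_sum, this]
  rw [condEntropy_eq_sub, h, sub_zero]
  exact entropy_congr p (fun ω ω' h => by simpa using h) fun ω ω' h => by simpa using h

theorem condEntropy_le_entropy [Fintype A] [Fintype B] (p : PMF Ω) (X : Ω → A) (Z : Ω → B) :
    condEntropy p X Z ≤ entropy p X := by
  rw [← condEntropy_const p X ()]
  exact condEntropy_le_of_factorsThrough p X fun _ _ _ => rfl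

/-- Subadditivity of conditional entropy, in joint form. -/
theorem entropy_pair_le [Fintype A] [Fintype B] (p : PMF Ω) (X : Ω → A) (Z : Ω → B) :
    entropy p (fun ω => (X ω, Z ω)) ≤ entropy p X + entropy p Z := by
  have := condEntropy_le_entropy p X Z
  rw [condEntropy_eq_sub] at this
  linarith

/-- Submodularity of entropy. -/
theorem entropy_submodular {D : Type*} [Fintype A] [Fintype B] [Fintype C] [Fintype D] (p : PMF Ω)
    {X : Ω → A} {Z : Ω → B} {S : Ω → C} {T : Ω → D} (h₁ : S.FactorsThrough X)
    (h₂ : S.FactorsThrough Z) (h₃ : T.FactorsThrough fun ω => (X ω, Z ω)) :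
    entropy p S + entropy p T ≤ entropy p X + entropy p Z := by
  have h4 := condEntropy_le_of_factorsThrough p X h₂
  rw [condEntropy_eq_sub, condEntropy_eq_sub] at h4
  have h5 := entropy_le_of_factorsThrough p h₃
  have h6 : entropy p (fun ω => (X ω, S ω)) = entropy p X :=
    entropy_congr p (fun ω ω' h => by simp [h, h₁ h]) fun ω ω' h => congrArg Prod.fst h
  linarith

/-- Gibbs' inequality against the uniform law. -/
theorem entropy_le_logb_card [Fintype A] (p : PMF Ω) (X : Ω → A) :
    entropy p X ≤ Real.logb 2 (Fintype.card A) := by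
  obtain ⟨ω₀, -⟩ := p.support_nonempty
  have : Nonempty A := ⟨X ω₀⟩
  have hc : (0 : ℝ) < Fintype.card A := Nat.cast_pos.2 Fintype.card_pos
  have := condEntropy_le_crossEntropy p X (fun _ => ()) (fun _ _ => (Fintype.card A : ℝ)⁻¹)
    (fun _ _ => by positivity) (fun _ => by simp) fun _ _ => by positivity
  rwa [condEntropy_const, ← Finset.sum_mul, sum_toReal, one_mul, Real.logb_inv, neg_neg] at this

open Classical in
/-- Fano's inequality. -/
theorem condEntropy_le_fano [Fintype A] [Fintype B] (p : PMF Ω) (W : Ω → A) (Y : Ω → B)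
    (d : B → A) :
    condEntropy p W Y ≤
      1 + (∑ ω, if d (Y ω) ≠ W ω then (p ω).toReal else 0) * Real.logb 2 (Fintype.card A) := by
  obtain ⟨ω₀, -⟩ := p.support_nonempty
  have : Nonempty A := ⟨W ω₀⟩
  have hc : (0 : ℝ) < Fintype.card A := Nat.cast_pos.2 Fintype.card_pos
  refine (condEntropy_le_crossEntropy p W Y
    -- Half of the mass sits on the decoded value, the rest is spread evenly over `A`: a correct
    -- guess costs one bit, a wrong one costs 1 + log₂ |A| bits.
    (fun a b => if d b ≠ a then (2 * (Fintype.card A : ℝ))⁻¹ else 2⁻¹)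
    (fun _ _ => by split_ifs <;> positivity) (fun b => ?_)
    fun _ _ => by split_ifs <;> positivity).trans_eq ?_
  · calc ∑ a, (if d b ≠ a then (2 * (Fintype.card A : ℝ))⁻¹ else 2⁻¹)
        ≤ ∑ a, ((2 * (Fintype.card A : ℝ))⁻¹ + if d b = a then 2⁻¹ else 0) := by
          refine Finset.sum_le_sum fun a _ => ?_
          by_cases h : d b = a
          · simp [h]
          · simp [h]
      _ = 1 := by
          rw [Finset.sum_add_distrib]
          simp
          field_simp
          norm_num
  · have : ∀ ω, (p ω).toReal *
        Real.logb 2 (if d (Y ω) ≠ W ω then (2 * (Fintype.card A : ℝ))⁻¹ else 2⁻¹) =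
        -((p ω).toReal +
          (if d (Y ω) ≠ W ω then (p ω).toReal else 0) * Real.logb 2 (Fintype.card A)) := by
      intro ω
      by_cases h : d (Y ω) = W ω
      · simp [h, Real.logb_inv]
      · simp only [ne_eq, h, not_false_eq_true, if_true]
        rw [Real.logb_inv, Real.logb_mul two_ne_zero hc.ne', Real.logb_self_eq_one one_lt_two]
        ring
    simp_rw [this]
    rw [Finset.sum_neg_distrib, neg_neg, Finset.sum_add_distrib, sum_toReal, Finset.sum_mul]

theorem entropy_uniform [Fintype A] [Nonempty A] :
    entropy (PMF.uniformOfFintype A) id = Real.logb 2 (Fintype.card A) := by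
  classical
  have : ∀ a, prob (PMF.uniformOfFintype A) id a = (Fintype.card A : ℝ)⁻¹ := by
    intro a
    simp [prob_eq_sum, PMF.uniformOfFintype_apply]
  rw [entropy]
  simp [this, Real.logb_inv]

end Entropy

/-! ### Laws of the form `p(u) p(x₁ | u) p(x₂ | u)` -/

section JointLaw

variable {Ω U₁ U₂ X₁ X₂ : Type*}

theorem jointLaw_apply (pU : PMF (U₁ × U₂)) (k₁ : U₁ × U₂ → PMF X₁) (k₂ : U₁ × U₂ → PMF X₂)
    (u : U₁ × U₂) (a : X₁) (b : X₂) :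
    jointLaw pU k₁ k₂ (u, (a, b)) = pU u * (k₁ u a * k₂ u b) := by
  classical
  rw [jointLaw, PMF.bind_apply, tsum_eq_single u]
  · rw [PMF.bind_apply, tsum_eq_single a]
    · rw [PMF.map_apply, tsum_eq_single b]
      · simp
      · intro b' hb'
        simp [hb'.symm]
    · intro a' ha'
      simp [PMF.map_apply, ha'.symm]
  · intro u' hu'
    simp [PMF.bind_apply, PMF.map_apply, hu'.symm]

theorem filter_map_apply {U X : Type*} (q : PMF Ω) (u : Ω → U) (x : Ω → X) (c : U)
    (h : ∃ ω ∈ u ⁻¹' {c}, ω ∈ q.support) (a : X) :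
    (q.filter (u ⁻¹' {c}) h).map x a = q.map (fun ω => (u ω, x ω)) (c, a) * (q.map u c)⁻¹ := by
  classical
  have h1 : ∑' ω, (u ⁻¹' {c}).indicator q ω = q.map u c := by
    rw [PMF.map_apply]
    refine tsum_congr fun ω => ?_
    simp [Set.indicator_apply, eq_comm]
  rw [PMF.map_apply, PMF.map_apply, ← ENNReal.tsum_mul_right]
  refine tsum_congr fun ω => ?_
  rw [PMF.filter_apply, h1]
  simp only [Set.indicator_apply, Set.mem_preimage, Set.mem_singleton_iff, Prod.mk.injEq]
  by_cases h2 : a = x ω <;> by_cases h3 : u ω = c <;> simp [h2, h3, eq_comm]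
  simp [Ne.symm h3]

/-- If `X₁` and `X₂` are conditionally independent given `(U₁, U₂)`, then the law of
`((U₁, U₂), (X₁, X₂))` has the product form. -/
theorem exists_map_eq_jointLaw [Fintype Ω] (q : PMF Ω) (u : Ω → U₁ × U₂) (x₁ : Ω → X₁)
    (x₂ : Ω → X₂)
    (h : ∀ c a b, prob q (fun ω => (u ω, (x₁ ω, x₂ ω))) (c, (a, b)) * prob q u c =
      prob q (fun ω => (u ω, x₁ ω)) (c, a) * prob q (fun ω => (u ω, x₂ ω)) (c, b)) :
    ∃ k₁ k₂, q.map (fun ω => (u ω, (x₁ ω, x₂ ω))) = jointLaw (q.map u) k₁ k₂ := by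
  classical
  obtain ⟨ω₀, -⟩ := q.support_nonempty
  -- The kernels are the conditional laws given `u = c`. Where `c` has probability zero an arbitrary
  -- point mass serves, since both sides vanish.
  refine ⟨fun c => if hc : ∃ ω ∈ u ⁻¹' {c}, ω ∈ q.support then (q.filter _ hc).map x₁ else
      PMF.pure (x₁ ω₀), fun c => if hc : ∃ ω ∈ u ⁻¹' {c}, ω ∈ q.support then
      (q.filter _ hc).map x₂ else PMF.pure (x₂ ω₀), ?_⟩
  ext ⟨c, a, b⟩
  rw [jointLaw_apply]
  by_cases hc : ∃ ω ∈ u ⁻¹' {c}, ω ∈ q.support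
  · rw [dif_pos hc, dif_pos hc, filter_map_apply, filter_map_apply]
    have h0 : q.map u c ≠ 0 := by
      obtain ⟨ω, h1, h2⟩ := hc
      exact (PMF.mem_support_map_iff _ _ _).2 ⟨ω, h2, h1⟩
    have hr : prob q u c ≠ 0 := (ENNReal.toReal_pos h0 (PMF.apply_ne_top _ _)).ne'
    have h1 := h c a b
    rw [← ENNReal.toReal_eq_toReal_iff' (PMF.apply_ne_top _ _)]
    · simp only [ENNReal.toReal_mul, ENNReal.toReal_inv]
      simp only [prob] at h1 hr
      field_simp
      linarith
    · have hi := ENNReal.inv_ne_top.2 h0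
      exact ENNReal.mul_ne_top (PMF.apply_ne_top _ _) (ENNReal.mul_ne_top
        (ENNReal.mul_ne_top (PMF.apply_ne_top _ _) hi)
        (ENNReal.mul_ne_top (PMF.apply_ne_top _ _) hi))
  · have h0 : q.map u c = 0 := by
      by_contra h0
      obtain ⟨ω, h1, h2⟩ := (PMF.mem_support_map_iff u q c).1 h0
      exact hc ⟨ω, h2, h1⟩
    rw [h0, zero_mul]
    by_contra h1
    obtain ⟨ω, h1, h2⟩ := (PMF.mem_support_map_iff _ q _).1 h1
    exact hc ⟨ω, congrArg Prod.fst h2, h1⟩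

end JointLaw

/-! ### The outer region is closed -/

section OuterRegion

variable {X₁ X₂ V₁ V₂ Y₁ Y₂ : Type*} [Fintype X₁] [Fintype X₂] [Fintype V₁] [Fintype V₂]
  [Fintype Y₁] [Fintype Y₂] {U₁ U₂ U₁' U₂' : Type*} [Fintype U₁] [Fintype U₂] [Fintype U₁']
  [Fintype U₂']

/-- Two laws with the same inputs, ordered by the entropies conditioned on the auxiliary variables,
have their sets of rate pairs ordered accordingly. -/
theorem boundsFor_mono (ch : DetIC X₁ X₂ V₁ V₂ Y₁ Y₂) {C₁ C₂ : ℝ}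
    {p : PMF ((U₁ × U₂) × (X₁ × X₂))} {p' : PMF ((U₁' × U₂') × (X₁ × X₂))}
    (hs : p.map Prod.snd = p'.map Prod.snd)
    (h₁ : condEntropy p (fun ω => ch.out₁ ω.2.1 ω.2.2)
        (fun ω => (ch.g₁ ω.2.1, ch.g₂ ω.2.2, ω.1.1)) ≤
      condEntropy p' (fun ω => ch.out₁ ω.2.1 ω.2.2)
        (fun ω => (ch.g₁ ω.2.1, ch.g₂ ω.2.2, ω.1.1)))
    (h₂ : condEntropy p (fun ω => ch.out₂ ω.2.1 ω.2.2) (fun ω => (ω.2.2, ω.1.1)) ≤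
      condEntropy p' (fun ω => ch.out₂ ω.2.1 ω.2.2) (fun ω => (ω.2.2, ω.1.1)))
    (h₃ : condEntropy p (fun ω => ch.out₁ ω.2.1 ω.2.2) (fun ω => (ω.2.2, ω.1.1)) ≤
      condEntropy p' (fun ω => ch.out₁ ω.2.1 ω.2.2) (fun ω => (ω.2.2, ω.1.1)))
    (h₄ : condEntropy p (fun ω => ch.out₂ ω.2.1 ω.2.2)
        (fun ω => (ch.g₁ ω.2.1, ch.g₂ ω.2.2, ω.1.2)) ≤
      condEntropy p' (fun ω => ch.out₂ ω.2.1 ω.2.2)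
        (fun ω => (ch.g₁ ω.2.1, ch.g₂ ω.2.2, ω.1.2)))
    (h₅ : condEntropy p (fun ω => ch.out₁ ω.2.1 ω.2.2) (fun ω => (ω.2.1, ω.1.2)) ≤
      condEntropy p' (fun ω => ch.out₁ ω.2.1 ω.2.2) (fun ω => (ω.2.1, ω.1.2)))
    (h₆ : condEntropy p (fun ω => ch.out₂ ω.2.1 ω.2.2) (fun ω => (ω.2.1, ω.1.2)) ≤
      condEntropy p' (fun ω => ch.out₂ ω.2.1 ω.2.2) (fun ω => (ω.2.1, ω.1.2))) :
    boundsFor ch C₁ C₂ p ⊆ boundsFor ch C₁ C₂ p' := by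
  have e₁ : entropy p (fun ω => ch.out₁ ω.2.1 ω.2.2) =
      entropy p' (fun ω => ch.out₁ ω.2.1 ω.2.2) := by
    simpa only [entropy_map] using
      congrArg (fun r => entropy r fun x : X₁ × X₂ => ch.out₁ x.1 x.2) hs
  have e₂ : entropy p (fun ω => ch.out₂ ω.2.1 ω.2.2) =
      entropy p' (fun ω => ch.out₂ ω.2.1 ω.2.2) := by
    simpa only [entropy_map] using
      congrArg (fun r => entropy r fun x : X₁ × X₂ => ch.out₂ x.1 x.2) hs
  have e₃ : condEntropy p (fun ω => ch.out₁ ω.2.1 ω.2.2) (fun ω => ch.g₁ ω.2.1) =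
      condEntropy p' (fun ω => ch.out₁ ω.2.1 ω.2.2) (fun ω => ch.g₁ ω.2.1) := by
    simpa only [condEntropy_map] using congrArg
      (fun r => condEntropy r (fun x : X₁ × X₂ => ch.out₁ x.1 x.2) fun x => ch.g₁ x.1) hs
  have e₄ : condEntropy p (fun ω => ch.out₂ ω.2.1 ω.2.2) (fun ω => ch.g₂ ω.2.2) =
      condEntropy p' (fun ω => ch.out₂ ω.2.1 ω.2.2) (fun ω => ch.g₂ ω.2.2) := by
    simpa only [condEntropy_map] using congrArg
      (fun r => condEntropy r (fun x : X₁ × X₂ => ch.out₂ x.1 x.2) fun x => ch.g₂ x.2) hs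
  simp only [DetIC.out₁, DetIC.out₂] at *
  rintro R ⟨b₁, b₂, b₃, b₄, b₅, b₆, b₇, b₈, b₉⟩
  rw [le_min_iff] at b₁ b₃
  refine ⟨le_min ?_ ?_, ?_, le_min ?_ ?_, ?_, ?_, ?_, ?_, ?_, ?_⟩ <;> linarith

/-- A law of the inputs as a joint law with trivial auxiliary variables. -/
noncomputable def trivialAux (p : PMF (X₁ × X₂)) : PMF ((Unit × Unit) × (X₁ × X₂)) :=
  p.map fun x => (((), ()), x)

/-- The auxiliaries occur only as conditions in terms with positive sign on the right, so forgetting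
them relaxes every bound. -/
theorem exists_trivialAux_of_mem_outerRegion {ch : DetIC X₁ X₂ V₁ V₂ Y₁ Y₂} {C₁ C₂ : ℝ}
    {R : ℝ × ℝ} (hR : R ∈ outerRegion ch C₁ C₂) :
    ∃ p : PMF (X₁ × X₂), R ∈ boundsFor ch C₁ C₂ (trivialAux p) := by
  obtain ⟨n₁, n₂, pU, k₁, k₂, hR⟩ := hR
  refine ⟨(jointLaw pU k₁ k₂).map Prod.snd, boundsFor_mono ch ?_ ?_ ?_ ?_ ?_ ?_ ?_ hR⟩
  · rw [trivialAux, PMF.map_comp, PMF.map_comp]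
    rfl
  all_goals
    rw [trivialAux, PMF.map_comp, condEntropy_map]
    refine condEntropy_le_of_factorsThrough _ _ fun ω ω' h => ?_
    simp only [Prod.mk.injEq, Function.comp_apply] at h ⊢
    tauto

/-- The product of the uniform law on `Fin n` and of the law `p`. -/
noncomputable def withKey {Ω : Type*} (n : ℕ) [NeZero n] (p : PMF Ω) : PMF (Fin n × Ω) :=
  (PMF.uniformOfFintype (Fin n)).bind fun k => p.map fun x => (k, x)

theorem withKey_apply {Ω : Type*} (n : ℕ) [NeZero n] (p : PMF Ω) (k : Fin n) (x : Ω) :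
    withKey n p (k, x) = (n : ENNReal)⁻¹ * p x := by
  classical
  rw [withKey, PMF.bind_apply, tsum_eq_single k]
  · rw [PMF.map_apply, tsum_eq_single x]
    · simp
    · intro x' hx'
      simp [hx'.symm]
  · intro k' hk'
    simp [PMF.map_apply, hk'.symm]

/-- For each message the encryption permutes the keys, so the ciphertext is again uniform and
independent of the message. -/
theorem map_add_withKey {Ω : Type*} (n : ℕ) [NeZero n] (p : PMF Ω) (e : Ω → Fin n) :
    (withKey n p).map (fun ω => (ω.1 + e ω.2, ω.2)) = withKey n p := by
  classical
  ext ⟨k, x⟩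
  rw [PMF.map_apply, tsum_eq_single (k - e x, x)]
  · simp [withKey_apply]
  · rintro ⟨k', x'⟩ h
    rw [if_neg]
    rintro h'
    simp only [Prod.mk.injEq] at h'
    apply h
    rw [h'.1, h'.2, add_sub_cancel_right]

/-- Neither the key nor a message encrypted with the key reveals anything about the message. -/
theorem condEntropy_le_condEntropy_withKey {Ω A B D : Type*} [Fintype Ω] [Fintype A] [Fintype B]
    [Fintype D] (n : ℕ) [NeZero n] (p : PMF Ω) (e : Ω → Fin n) (F : Ω → A) (G : Ω → B)
    (Z : Fin n × Ω → D) (hZ : Z.FactorsThrough fun ω => (G ω.2, ω.1 + e ω.2)) :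
    condEntropy p F G ≤ condEntropy (withKey n p) (fun ω => F ω.2) Z := by
  have h := sum_condEntropy_le_of_mixture p (withKey n p) (fun k x => by
    rw [withKey_apply, Fintype.card_fin, ENNReal.toReal_mul, ENNReal.toReal_inv,
      ENNReal.toReal_natCast, mul_inv_cancel_left₀ (Nat.cast_ne_zero.2 (NeZero.ne n))])
    (fun ω => F ω.2) (fun ω => (G ω.2, ω.1))
  have h' : ∀ k : Fin n, condEntropy p F (fun x => (G x, k)) = condEntropy p F G := fun k =>
    condEntropy_congr p F (fun x x' h => congrArg Prod.fst h) fun x x' h => by simp [h]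
  simp only [h', Finset.sum_const, Finset.card_univ, Fintype.card_fin, nsmul_eq_mul] at h
  have h2 := le_of_mul_le_mul_left h (Nat.cast_pos.2 (Nat.pos_of_ne_zero (NeZero.ne n)))
  rw [← map_add_withKey n p e, condEntropy_map] at h2
  exact h2.trans (condEntropy_le_of_factorsThrough _ _ hZ)

/-- One-time pad: the pair consisting of a uniform key and of the inputs encrypted with the key
determines the inputs, although each of its two components is independent of the inputs. -/
theorem mem_outerRegion_of_trivialAux {ch : DetIC X₁ X₂ V₁ V₂ Y₁ Y₂} {C₁ C₂ : ℝ}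
    {R : ℝ × ℝ} (p : PMF (X₁ × X₂)) (hR : R ∈ boundsFor ch C₁ C₂ (trivialAux p)) :
    R ∈ outerRegion ch C₁ C₂ := by
  obtain ⟨x₀, -⟩ := p.support_nonempty
  set n := Fintype.card (X₁ × X₂) with hn
  have : NeZero n := ⟨(Fintype.card_pos_iff.2 ⟨x₀⟩).ne'⟩
  let e : X₁ × X₂ ≃ Fin n := Fintype.equivFin _
  let u : Fin n × (X₁ × X₂) → Fin n × Fin n := fun ω => (ω.1, ω.1 + e ω.2)
  -- Decryption: the inputs are a function of (U₁, U₂), so point masses serve as kernels and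
  -- conditional independence is automatic.
  let f : Fin n × Fin n → X₁ × X₂ := fun c => e.symm (c.2 - c.1)
  have hlaw : jointLaw ((withKey n p).map u) (fun c => PMF.pure (f c).1)
      (fun c => PMF.pure (f c).2) = (withKey n p).map fun ω => (u ω, ω.2) := by
    have : ∀ ω, f (u ω) = ω.2 := fun ω => by simp [f, u]
    simp only [jointLaw, PMF.pure_bind, PMF.pure_map, PMF.bind_map]
    rw [← PMF.bind_pure_comp]
    congr 1
    funext ω
    simp [this]
  have hsnd : (withKey n p).map Prod.snd = p := by
    simp only [withKey, PMF.map_bind, PMF.map_comp]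
    exact (PMF.bind_const _ _).trans (PMF.map_id p)
  refine ⟨n, n, (withKey n p).map u, fun c => PMF.pure (f c).1, fun c => PMF.pure (f c).2, ?_⟩
  rw [hlaw]
  refine boundsFor_mono ch ?_ ?_ ?_ ?_ ?_ ?_ ?_ hR
  · rw [trivialAux, PMF.map_comp, PMF.map_comp]
    exact (PMF.map_id p).trans hsnd.symm
  -- Three of the terms see only U₁, the bare key, which is encryption with `e = 0`; the other three
  -- see only U₂, the ciphertext.
  iterate 3
    rw [trivialAux, condEntropy_map, condEntropy_map]
    refine condEntropy_le_condEntropy_withKey n p (fun _ => 0) _ _ _ fun ω ω' h => ?_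
    simp only [Prod.mk.injEq, add_zero, u] at h ⊢
    tauto
  all_goals
    rw [trivialAux, condEntropy_map, condEntropy_map]
    refine condEntropy_le_condEntropy_withKey n p e _ _ _ fun ω ω' h => ?_
    simp only [Prod.mk.injEq, u] at h ⊢
    tauto

/-- The probability mass function of a point of the standard simplex. -/
noncomputable def simplexPMF {Ω : Type*} [Fintype Ω] (f : stdSimplex ℝ Ω) : PMF Ω :=
  PMF.ofFintype (fun ω => ENNReal.ofReal (f.1 ω)) (by
    rw [← ENNReal.ofReal_sum_of_nonneg fun ω _ => f.2.1 ω, f.2.2, ENNReal.ofReal_one])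

theorem exists_simplexPMF_eq {Ω : Type*} [Fintype Ω] (p : PMF Ω) : ∃ f, simplexPMF f = p := by
  refine ⟨⟨fun ω => (p ω).toReal, fun _ => ENNReal.toReal_nonneg, sum_toReal p⟩, ?_⟩
  ext ω
  simp [simplexPMF, ENNReal.ofReal_toReal (p.apply_ne_top ω)]

/-- The function t log t is continuous also at 0, so vanishing probabilities do no harm. -/
theorem continuous_entropy_simplexPMF {Ω A : Type*} [Fintype Ω] [Fintype A] (X : Ω → A) :
    Continuous fun f => entropy (simplexPMF f) X := by
  classical
  have h : ∀ (f : stdSimplex ℝ Ω) a,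
      prob (simplexPMF f) X a = ∑ ω, if X ω = a then f.1 ω else 0 := by
    intro f a
    rw [prob_eq_sum]
    refine Finset.sum_congr rfl fun ω _ => ?_
    rw [simplexPMF, PMF.ofFintype_apply, ENNReal.toReal_ofReal (f.2.1 ω)]
  have h' : ∀ f, entropy (simplexPMF f) X =
      ∑ a, Real.negMulLog (∑ ω, if X ω = a then f.1 ω else 0) / Real.log 2 := by
    intro f
    rw [entropy, ← Finset.sum_neg_distrib]
    refine Finset.sum_congr rfl fun a _ => ?_
    rw [h, Real.negMulLog, Real.logb]
    ring
  simp_rw [h']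
  refine continuous_finsetSum _ fun a _ => (Real.continuous_negMulLog.comp ?_).div_const _
  refine continuous_finsetSum _ fun ω _ => ?_
  split_ifs
  · exact (continuous_apply ω).comp continuous_subtype_val
  · exact continuous_const

theorem continuous_condEntropy_simplexPMF {Ω A B : Type*} [Fintype Ω] [Fintype A] [Fintype B]
    (X : Ω → A) (Z : Ω → B) : Continuous fun f => condEntropy (simplexPMF f) X Z := by
  simp_rw [condEntropy_eq_sub]
  exact (continuous_entropy_simplexPMF _).sub (continuous_entropy_simplexPMF _)

/-- The outer region is closed, although the alphabets of the auxiliary variables are unbounded: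
by the one-time pad it is a projection of a closed set along the compact simplex of input laws. -/
theorem isClosed_outerRegion (ch : DetIC X₁ X₂ V₁ V₂ Y₁ Y₂) (C₁ C₂ : ℝ) :
    IsClosed (outerRegion ch C₁ C₂) := by
  let S : Set ((ℝ × ℝ) × stdSimplex ℝ ((Unit × Unit) × (X₁ × X₂))) :=
    {z | z.1 ∈ boundsFor ch C₁ C₂ (simplexPMF z.2)}
  have hS : IsClosed S := by
    have h₁ : Continuous fun z : (ℝ × ℝ) × stdSimplex ℝ ((Unit × Unit) × (X₁ × X₂)) => z.1.1 :=
      continuous_fst.comp continuous_fst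
    have h₂ : Continuous fun z : (ℝ × ℝ) × stdSimplex ℝ ((Unit × Unit) × (X₁ × X₂)) => z.1.2 :=
      continuous_snd.comp continuous_fst
    simp only [S, boundsFor, le_min_iff, Set.ofPred_and]
    refine ((IsClosed.inter ?_ ?_).inter (IsClosed.inter ?_ (IsClosed.inter (IsClosed.inter ?_ ?_)
      (IsClosed.inter ?_ (IsClosed.inter ?_ (IsClosed.inter ?_ (IsClosed.inter ?_
        (IsClosed.inter ?_ ?_))))))))
    all_goals
      refine isClosed_le (by fun_prop) ?_
      repeat' first
        | exact continuous_const
        | exact (continuous_entropy_simplexPMF _).comp continuous_snd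
        | exact (continuous_condEntropy_simplexPMF _ _).comp continuous_snd
        | refine Continuous.add ?_ ?_
  have hout : outerRegion ch C₁ C₂ = Prod.fst '' S := by
    ext R
    constructor
    · intro hR
      obtain ⟨p, hp⟩ := exists_trivialAux_of_mem_outerRegion hR
      obtain ⟨f, hf⟩ := exists_simplexPMF_eq (trivialAux p)
      exact ⟨(R, f), by simpa [S, hf] using hp, rfl⟩
    · rintro ⟨⟨R, f⟩, hz, rfl⟩
      refine mem_outerRegion_of_trivialAux ((simplexPMF f).map Prod.snd) ?_
      have h : (simplexPMF f).map ((fun x => (((), ()), x)) ∘ Prod.snd) = simplexPMF f :=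
        PMF.map_id _
      rw [trivialAux, PMF.map_comp, h]
      exact hz
  rw [hout]
  exact isClosedMap_fst_of_compactSpace S hS

end OuterRegion

/-! ### Sequences -/

section Sequences

variable {Ω A B C : Type*} {N : ℕ}

/-- The first `n` terms of a sequence of length `N`, padded by `none`. -/
def initialSegment (a : Fin N → A) (n : ℕ) : Fin N → Option A :=
  fun j => if j.1 < n then some (a j) else none

theorem initialSegment_eq_iff {a b : Fin N → A} {n : ℕ} :
    initialSegment a n = initialSegment b n ↔ ∀ j : Fin N, j.1 < n → a j = b j := by
  simp only [initialSegment, funext_iff]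
  refine forall_congr' fun j => ?_
  by_cases h : j.1 < n <;> simp [h]

/-- The chain rule for a sequence. -/
theorem condEntropy_eq_sum_initialSegment [Fintype Ω] [Fintype A] [Fintype B] (p : PMF Ω)
    (y : Ω → Fin N → A) (Z : Ω → B) :
    condEntropy p y Z =
      ∑ i, condEntropy p (fun ω => y ω i) (fun ω => (Z ω, initialSegment (y ω) i)) := by
  -- The i-th summand is an increment of `h`, and the sum telescopes from H(Z) to H(y, Z).
  let h : ℕ → ℝ := fun n => entropy p fun ω => (Z ω, initialSegment (y ω) n)
  have h1 : ∀ i : Fin N,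
      condEntropy p (fun ω => y ω i) (fun ω => (Z ω, initialSegment (y ω) i)) =
        h (i + 1) - h i := by
    intro i
    rw [condEntropy_eq_sub]
    congr 1
    refine entropy_congr p (fun ω ω' hω => ?_) fun ω ω' hω => ?_
    · simp only [Prod.mk.injEq, initialSegment_eq_iff] at hω ⊢
      exact ⟨hω.2 i (Nat.lt_succ_self _), hω.1, fun j hj => hω.2 j (hj.trans (Nat.lt_succ_self _))⟩
    · simp only [Prod.mk.injEq, initialSegment_eq_iff] at hω ⊢
      refine ⟨hω.2.1, fun j hj => ?_⟩
      rcases (Nat.lt_succ_iff.1 hj).lt_or_eq with hj | hj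
      · exact hω.2.2 j hj
      · rw [Fin.ext hj]
        exact hω.1
  simp_rw [h1]
  rw [Fin.sum_univ_eq_sum_range (fun n => h (n + 1) - h n) N, Finset.sum_range_sub,
    condEntropy_eq_sub]
  congr 1
  · refine entropy_congr p (fun ω ω' hω => ?_) fun ω ω' hω => ?_
    · simp only [Prod.mk.injEq, initialSegment_eq_iff] at hω ⊢
      exact ⟨funext fun j => hω.2 j j.2, hω.1⟩
    · simp only [Prod.mk.injEq, initialSegment_eq_iff] at hω ⊢
      exact ⟨hω.2, fun j _ => congrFun hω.1 j⟩
  · refine entropy_congr p (fun ω ω' hω => ?_) fun ω ω' hω => ?_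
    · exact congrArg Prod.fst hω
    · simp only [Prod.mk.injEq, initialSegment_eq_iff]
      exact ⟨hω, fun j hj => absurd hj (Nat.not_lt_zero _)⟩

/-- Single-letterization: the entropy of a sequence is bounded by the entropies of its terms at a
uniform time, conditioned on anything known from the past. -/
theorem condEntropy_le_card_mul [Fintype Ω] [Fintype A] [Fintype B] [Fintype C] (p : PMF Ω)
    (q : PMF (Fin N × Ω)) (hq : ∀ i ω, (N : ℝ) * (q (i, ω)).toReal = (p ω).toReal)
    (y : Ω → Fin N → A) (Z : Ω → B) (T : Fin N × Ω → C)
    (hT : ∀ i ω ω', Z ω = Z ω' → (∀ j < i, y ω j = y ω' j) → T (i, ω) = T (i, ω')) :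
    condEntropy p y Z ≤ N * condEntropy q (fun ω => y ω.2 ω.1) T := by
  have h := sum_condEntropy_le_of_mixture p q (by simpa using hq) (fun ω => y ω.2 ω.1) T
  rw [Fintype.card_fin] at h
  refine le_trans ?_ h
  rw [condEntropy_eq_sum_initialSegment]
  refine Finset.sum_le_sum fun i _ => condEntropy_le_of_factorsThrough p _ fun ω ω' hω => ?_
  simp only [Prod.mk.injEq, initialSegment_eq_iff] at hω
  exact hT i ω ω' hω.1 hω.2

end Sequences

/-! ### The channel -/

section Channel

variable {X₁ X₂ V₁ V₂ Y₁ Y₂ : Type*}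

/-- The channel with the two users exchanged. -/
def DetIC.swap (ch : DetIC X₁ X₂ V₁ V₂ Y₁ Y₂) : DetIC X₂ X₁ V₂ V₁ Y₂ Y₁ :=
  ⟨ch.g₂, ch.g₁, ch.f₂, ch.f₁⟩

/-- Each receiver can recover the interference once it knows its own transmitter's input. -/
structure DetIC.Resolves (ch : DetIC X₁ X₂ V₁ V₂ Y₁ Y₂) : Prop where
  fst : ∀ x₁ x₂ x₂', ch.out₁ x₁ x₂ = ch.out₁ x₁ x₂' → ch.g₂ x₂ = ch.g₂ x₂'
  snd : ∀ x₂ x₁ x₁', ch.out₂ x₁ x₂ = ch.out₂ x₁' x₂ → ch.g₁ x₁ = ch.g₁ x₁'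

theorem DetIC.Resolves.swap {ch : DetIC X₁ X₂ V₁ V₂ Y₁ Y₂} (h : ch.Resolves) :
    ch.swap.Resolves :=
  ⟨h.snd, h.fst⟩

/-- If `G` does not separate the two equally likely points but `F` does, the conditional entropy is
one bit. Testing the El Gamal–Costa condition on two-point laws thus turns it into a pointwise
statement. -/
theorem eq_of_condEntropy_eq_zero {A B : Type*} [Fintype A] [Fintype B] (F : Bool → A)
    (G : Bool → B) (h : condEntropy (PMF.uniformOfFintype Bool) F G = 0)
    (hG : G true = G false) : F true = F false := by
  by_contra hF
  have hG' : G = fun _ => G true := by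
    funext b
    cases b
    · exact hG.symm
    · rfl
  rw [hG', condEntropy_const, entropy_congr (X := F) (Z := id) _ (fun b b' h => congrArg F h),
    entropy_uniform] at h
  · norm_num at h
  · intro b b' hb
    cases b <;> cases b' <;> first | rfl | exact absurd hb hF | exact absurd hb.symm hF

theorem DetIC.IsElGamalCosta.resolves [Fintype X₁] [Fintype X₂] [Fintype V₁] [Fintype V₂]
    [Fintype Y₁] [Fintype Y₂] {ch : DetIC X₁ X₂ V₁ V₂ Y₁ Y₂} (h : ch.IsElGamalCosta) :
    ch.Resolves := by
  refine ⟨fun x₁ x₂ x₂' hx => ?_, fun x₂ x₁ x₁' hx => ?_⟩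
  · have h1 := (h ((PMF.uniformOfFintype Bool).map fun b => (x₁, cond b x₂ x₂'))).1
    rw [condEntropy_map] at h1
    exact eq_of_condEntropy_eq_zero _ _ h1 (congrArg (fun y => (y, x₁)) hx)
  · have h1 := (h ((PMF.uniformOfFintype Bool).map fun b => (cond b x₁ x₁', x₂))).2
    rw [condEntropy_map] at h1
    exact eq_of_condEntropy_eq_zero _ _ h1 (congrArg (fun y => (y, x₂)) hx)

end Channel

/-! ### Transmissions with feedback -/

/-- The random variables of a block transmission with feedback: the messages `wₖ`, the channel
inputs `xₖ` and the feedback sequences `sₖ`. -/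
structure Transmission {X₁ X₂ V₁ V₂ Y₁ Y₂ : Type*} (ch : DetIC X₁ X₂ V₁ V₂ Y₁ Y₂)
    (Ω W₁ W₂ S₁ S₂ : Type*) (N : ℕ) where
  w₁ : Ω → W₁
  w₂ : Ω → W₂
  x₁ : Ω → Fin N → X₁
  x₂ : Ω → Fin N → X₂
  s₁ : Ω → S₁
  s₂ : Ω → S₂
  ext_w : ∀ {ω ω'}, w₁ ω = w₁ ω' → w₂ ω = w₂ ω' → ω = ω'
  causal₁ : ∀ {i ω ω'}, w₁ ω = w₁ ω' →
    (∀ j < i, ch.out₁ (x₁ ω j) (x₂ ω j) = ch.out₁ (x₁ ω' j) (x₂ ω' j)) → x₁ ω i = x₁ ω' i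
  causal₂ : ∀ {i ω ω'}, w₂ ω = w₂ ω' →
    (∀ j < i, ch.out₂ (x₁ ω j) (x₂ ω j) = ch.out₂ (x₁ ω' j) (x₂ ω' j)) → x₂ ω i = x₂ ω' i
  feedback₁ : ∀ {ω ω'}, w₁ ω = w₁ ω' → s₁ ω = s₁ ω' → x₁ ω = x₁ ω'
  feedback₂ : ∀ {ω ω'}, w₂ ω = w₂ ω' → s₂ ω = s₂ ω' → x₂ ω = x₂ ω'

namespace Transmission

variable {X₁ X₂ V₁ V₂ Y₁ Y₂ : Type*} {ch : DetIC X₁ X₂ V₁ V₂ Y₁ Y₂} {Ω W₁ W₂ S₁ S₂ : Type*}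
  {N : ℕ} (T : Transmission ch Ω W₁ W₂ S₁ S₂ N)

/-- The transmission with the two users exchanged. -/
def swap : Transmission ch.swap Ω W₂ W₁ S₂ S₁ N where
  w₁ := T.w₂
  w₂ := T.w₁
  x₁ := T.x₂
  x₂ := T.x₁
  s₁ := T.s₂
  s₂ := T.s₁
  ext_w h h' := T.ext_w h' h
  causal₁ := T.causal₂
  causal₂ := T.causal₁
  feedback₁ := T.feedback₂
  feedback₂ := T.feedback₁

def v₁ (ω : Ω) (i : Fin N) : V₁ := ch.g₁ (T.x₁ ω i)

def v₂ (ω : Ω) (i : Fin N) : V₂ := ch.g₂ (T.x₂ ω i)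

def y₁ (ω : Ω) (i : Fin N) : Y₁ := ch.out₁ (T.x₁ ω i) (T.x₂ ω i)

def y₂ (ω : Ω) (i : Fin N) : Y₂ := ch.out₂ (T.x₁ ω i) (T.x₂ ω i)

/-- The auxiliary variable of user 1 at time `i`: the time and the past interference at
receiver 1. -/
def aux₁ (ω : Fin N × Ω) : Fin N × (Fin N → Option V₂) :=
  (ω.1, initialSegment (T.v₂ ω.2) ω.1)

/-- The auxiliary variable of user 2 at time `i`: the time and the past interference at
receiver 2. -/
def aux₂ (ω : Fin N × Ω) : Fin N × (Fin N → Option V₁) :=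
  (ω.1, initialSegment (T.v₁ ω.2) ω.1)

theorem x₁_eq {i : Fin N} {ω ω' : Ω} (hw : T.w₁ ω = T.w₁ ω')
    (hy : ∀ j < i, T.y₁ ω j = T.y₁ ω' j) : ∀ j ≤ i, T.x₁ ω j = T.x₁ ω' j :=
  fun _ hj => T.causal₁ hw fun l hl => hy l (hl.trans_le hj)

theorem x₂_eq {i : Fin N} {ω ω' : Ω} (hw : T.w₂ ω = T.w₂ ω')
    (hy : ∀ j < i, T.y₂ ω j = T.y₂ ω' j) : ∀ j ≤ i, T.x₂ ω j = T.x₂ ω' j :=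
  fun _ hj => T.causal₂ hw fun l hl => hy l (hl.trans_le hj)

theorem v₁_eq {i : Fin N} {ω ω' : Ω} (hx : T.x₁ ω i = T.x₁ ω' i) : T.v₁ ω i = T.v₁ ω' i :=
  congrArg ch.g₁ hx

theorem v₂_eq {i : Fin N} {ω ω' : Ω} (hx : T.x₂ ω i = T.x₂ ω' i) : T.v₂ ω i = T.v₂ ω' i :=
  congrArg ch.g₂ hx

theorem v₂_eq_of_y₁ (hch : ch.Resolves) {i : Fin N} {ω ω' : Ω} (hx : T.x₁ ω i = T.x₁ ω' i)
    (hy : T.y₁ ω i = T.y₁ ω' i) : T.v₂ ω i = T.v₂ ω' i := by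
  refine hch.fst (T.x₁ ω i) _ _ (hy.trans ?_)
  rw [y₁, hx]

/-- The message and the past outputs give the current input of user 1, and that input with the
current output gives the interference. -/
theorem v₂_factorsThrough (hch : ch.Resolves) :
    T.v₂.FactorsThrough fun ω => (T.y₁ ω, T.w₁ ω) := by
  intro ω ω' h
  simp only [Prod.mk.injEq] at h
  exact funext fun i => T.v₂_eq_of_y₁ hch
    (T.x₁_eq h.2 (fun j _ => congrFun h.1 j) i le_rfl) (congrFun h.1 i)

theorem x₂_factorsThrough : T.x₂.FactorsThrough fun ω => (T.y₂ ω, T.w₂ ω) := by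
  intro ω ω' h
  simp only [Prod.mk.injEq] at h
  exact funext fun i => T.x₂_eq h.2 (fun j _ => congrFun h.1 j) i le_rfl

theorem initialSegment_v₂ {i : Fin N} {ω ω' : Ω} (h : ∀ j < i, T.v₂ ω j = T.v₂ ω' j) :
    initialSegment (T.v₂ ω) i = initialSegment (T.v₂ ω') i :=
  initialSegment_eq_iff.2 h

/-! ### Block entropy inequalities and their single-letter forms -/

section Bounds

set_option linter.unusedSectionVars false

variable [Fintype Ω] [Fintype W₁] [Fintype W₂] [Fintype S₁] [Fintype S₂] [Fintype X₁] [Fintype X₂]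
  [Fintype V₁] [Fintype V₂] [Fintype Y₁] [Fintype Y₂] (p : PMF Ω)

theorem condEntropy_v₂_le (hch : ch.Resolves) :
    condEntropy p T.v₂ T.w₁ ≤ condEntropy p T.y₁ T.w₁ := by
  rw [condEntropy_eq_sub, condEntropy_eq_sub]
  have := entropy_le_of_factorsThrough p (X := fun ω => (T.v₂ ω, T.w₁ ω))
    (Z := fun ω => (T.y₁ ω, T.w₁ ω)) fun ω ω' h =>
      Prod.ext (T.v₂_factorsThrough hch h) (Prod.ext_iff.1 h).2
  linarith

/-- Both sides equal H(W₁, Y₁). -/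
theorem entropy_w₁_add_condEntropy_le :
    entropy p T.w₁ + condEntropy p T.y₁ T.w₁ ≤ entropy p T.y₁ + condEntropy p T.w₁ T.y₁ := by
  rw [condEntropy_eq_sub, condEntropy_eq_sub, entropy_congr p (X := fun ω => (T.w₁ ω, T.y₁ ω))
    (Z := fun ω => (T.y₁ ω, T.w₁ ω))]
  · linarith
  all_goals
    intro ω ω' h
    simp_all

/-- H(Y₁) ≤ H(Y₁|V₁) + H(V₁). The price H(V₁) is later paid through user 2's message and feedback
link 1. -/
theorem entropy_w₁_add_condEntropy_le_condEntropy_v₁ :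
    entropy p T.w₁ + condEntropy p T.y₁ T.w₁ ≤
      condEntropy p T.y₁ T.v₁ + entropy p T.v₁ + condEntropy p T.w₁ T.y₁ := by
  have h := entropy_w₁_add_condEntropy_le T p
  have h' := entropy_le_of_factorsThrough p (X := T.y₁) (Z := fun ω => (T.y₁ ω, T.v₁ ω))
    fun ω ω' h => congrArg Prod.fst h
  have := condEntropy_eq_sub p T.y₁ T.v₁
  linarith

/-- A genie gives (Y₂, W₂) to receiver 1: expand H(W₁, Y₁, Y₂, W₂) by the chain rule and cancel
H(W₂) by independence. -/
theorem entropy_w₁_le (hind : entropy p T.w₁ + entropy p T.w₂ =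
      entropy p fun ω => (T.w₁ ω, T.w₂ ω)) :
    entropy p T.w₁ ≤ condEntropy p T.y₂ T.w₂ +
      condEntropy p T.y₁ (fun ω => (T.y₂ ω, T.w₂ ω)) + condEntropy p T.w₁ T.y₁ := by
  have h1 := condEntropy_le_of_factorsThrough p T.w₁ (Z := T.y₁)
    (Z' := fun ω => (T.y₁ ω, (T.y₂ ω, T.w₂ ω))) fun ω ω' h => congrArg Prod.fst h
  have h2 := entropy_le_of_factorsThrough p (X := fun ω => (T.w₁ ω, T.w₂ ω))
    (Z := fun ω => (T.w₁ ω, (T.y₁ ω, (T.y₂ ω, T.w₂ ω)))) fun ω ω' h => by simp_all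
  rw [condEntropy_eq_sub] at h1
  rw [condEntropy_eq_sub p T.y₂ T.w₂, condEntropy_eq_sub p T.y₁]
  linarith

/-- The genie now gives only (S₂, W₂), so H(Y₂|W₂) is replaced by the entropy of the feedback. -/
theorem entropy_w₁_le_of_feedback (hind : entropy p T.w₁ + entropy p T.w₂ =
      entropy p fun ω => (T.w₁ ω, T.w₂ ω)) :
    entropy p T.w₁ ≤ condEntropy p T.y₁ (fun ω => (T.s₂ ω, T.w₂ ω)) + entropy p T.s₂ +
      condEntropy p T.w₁ T.y₁ := by
  have h1 := condEntropy_le_of_factorsThrough p T.w₁ (Z := T.y₁)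
    (Z' := fun ω => (T.y₁ ω, (T.s₂ ω, T.w₂ ω))) fun ω ω' h => congrArg Prod.fst h
  have h2 := entropy_le_of_factorsThrough p (X := fun ω => (T.w₁ ω, T.w₂ ω))
    (Z := fun ω => (T.w₁ ω, (T.y₁ ω, (T.s₂ ω, T.w₂ ω)))) fun ω ω' h => by simp_all
  have h3 := entropy_pair_le p T.s₂ T.w₂
  rw [condEntropy_eq_sub] at h1
  rw [condEntropy_eq_sub p T.y₁]
  linarith

/-- Whatever transmitter 2 reveals about the message of user 1, it knows from the feedback. -/
theorem entropy_v₂_le (hind : entropy p T.w₁ + entropy p T.w₂ =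
      entropy p fun ω => (T.w₁ ω, T.w₂ ω)) :
    entropy p T.v₂ ≤ condEntropy p T.v₂ T.w₁ + entropy p T.s₂ := by
  -- V₂ is determined by (V₂, W₁) and also by (S₂, W₂), while the two pairs together contain both
  -- messages.
  have h1 := entropy_submodular p (X := fun ω => (T.v₂ ω, T.w₁ ω))
    (Z := fun ω => (T.s₂ ω, T.w₂ ω)) (S := T.v₂) (T := fun ω => (T.w₁ ω, T.w₂ ω))
    (fun ω ω' h => congrArg Prod.fst h)
    (fun ω ω' h => funext fun i => T.v₂_eq (congrFun (T.feedback₂ (congrArg Prod.snd h)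
      (congrArg Prod.fst h)) i)) (fun ω ω' h => by simp_all)
  have h2 := entropy_pair_le p T.s₂ T.w₂
  rw [condEntropy_eq_sub]
  linarith

variable (q : PMF (Fin N × Ω))

theorem entropy_y₁_le (hq : ∀ i ω, (N : ℝ) * (q (i, ω)).toReal = (p ω).toReal) :
    entropy p T.y₁ ≤ N * entropy q (fun ω => T.y₁ ω.2 ω.1) := by
  have := condEntropy_le_card_mul p q hq T.y₁ (fun _ => ()) (fun _ => ()) fun _ _ _ _ _ => rfl
  rwa [condEntropy_const, condEntropy_const] at this

theorem condEntropy_y₁_v₁_le (hq : ∀ i ω, (N : ℝ) * (q (i, ω)).toReal = (p ω).toReal) :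
    condEntropy p T.y₁ T.v₁ ≤
    N * condEntropy q (fun ω => T.y₁ ω.2 ω.1) (fun ω => T.v₁ ω.2 ω.1) :=
  condEntropy_le_card_mul p q hq T.y₁ T.v₁ _ fun i _ _ h _ => congrFun h i

theorem condEntropy_y₁_le (hq : ∀ i ω, (N : ℝ) * (q (i, ω)).toReal = (p ω).toReal)
    (hch : ch.Resolves) :
    condEntropy p T.y₁ (fun ω => (T.y₂ ω, T.w₂ ω)) ≤
      N * condEntropy q (fun ω => T.y₁ ω.2 ω.1)
        (fun ω => (T.v₁ ω.2 ω.1, T.v₂ ω.2 ω.1, T.aux₁ ω)) := by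
  refine condEntropy_le_card_mul p q hq T.y₁ _ _ fun i ω ω' h _ => ?_
  have h1 := T.swap.v₂_factorsThrough hch.swap h
  have h2 := T.x₂_factorsThrough h
  exact Prod.ext (congrFun h1 i) (Prod.ext (T.v₂_eq (congrFun h2 i)) (Prod.ext rfl
    (T.initialSegment_v₂ fun j _ => T.v₂_eq (congrFun h2 j))))

theorem condEntropy_y₁_feedback_le
    (hq : ∀ i ω, (N : ℝ) * (q (i, ω)).toReal = (p ω).toReal) :
    condEntropy p T.y₁ (fun ω => (T.s₂ ω, T.w₂ ω)) ≤
      N * condEntropy q (fun ω => T.y₁ ω.2 ω.1) (fun ω => (T.x₂ ω.2 ω.1, T.aux₁ ω)) := by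
  refine condEntropy_le_card_mul p q hq T.y₁ _ _ fun i ω ω' h _ => ?_
  have h2 := T.feedback₂ (congrArg Prod.snd h) (congrArg Prod.fst h)
  exact Prod.ext (congrFun h2 i) (Prod.ext rfl
    (T.initialSegment_v₂ fun j _ => T.v₂_eq (congrFun h2 j)))

/-- Here X₂ is known only up to and including the current time, from W₂ and the strictly past
outputs; this suffices for U₁. -/
theorem condEntropy_y₂_le (hq : ∀ i ω, (N : ℝ) * (q (i, ω)).toReal = (p ω).toReal) :
    condEntropy p T.y₂ T.w₂ ≤
      N * condEntropy q (fun ω => T.y₂ ω.2 ω.1) (fun ω => (T.x₂ ω.2 ω.1, T.aux₁ ω)) := by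
  refine condEntropy_le_card_mul p q hq T.y₂ _ _ fun i ω ω' h hy => ?_
  have h2 := T.x₂_eq h hy
  exact Prod.ext (h2 i le_rfl) (Prod.ext rfl
    (T.initialSegment_v₂ fun j hj => T.v₂_eq (h2 j hj.le)))

/-- The law of the auxiliary variables and of the inputs at a random time. -/
noncomputable def letterLaw : PMF (((Fin N × (Fin N → Option V₂)) × (Fin N × (Fin N → Option V₁))) ×
    (X₁ × X₂)) :=
  q.map fun ω => ((T.aux₁ ω, T.aux₂ ω), (T.x₁ ω.2 ω.1, T.x₂ ω.2 ω.1))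

/-- The nine bounds, in single-letter form, for a transmission over `N` channel uses. -/
theorem mem_boundsFor (hq : ∀ i ω, (N : ℝ) * (q (i, ω)).toReal = (p ω).toReal) (hN : 0 < N)
    (hch : ch.Resolves) (hind : entropy p T.w₁ + entropy p T.w₂ =
      entropy p fun ω => (T.w₁ ω, T.w₂ ω)) {C₁ C₂ e₁ e₂ : ℝ}
    (hs₁ : entropy p T.s₁ ≤ N * C₁) (hs₂ : entropy p T.s₂ ≤ N * C₂)
    (he₁ : condEntropy p T.w₁ T.y₁ ≤ e₁) (he₂ : condEntropy p T.w₂ T.y₂ ≤ e₂) :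
    ((entropy p T.w₁ - e₁) / N, (entropy p T.w₂ - e₂) / N) ∈
      boundsFor ch C₁ C₂ (letterLaw T q) := by
  have hN' : (0 : ℝ) < N := Nat.cast_pos.2 hN
  have hind' : entropy p T.w₂ + entropy p T.w₁ = entropy p fun ω => (T.w₂ ω, T.w₁ ω) := by
    rw [add_comm, hind]
    exact entropy_congr p (fun ω ω' h => by simp_all) fun ω ω' h => by simp_all
  have a₁ := T.condEntropy_v₂_le p hch
  have a₂ : condEntropy p T.v₁ T.w₂ ≤ condEntropy p T.y₂ T.w₂ :=
    T.swap.condEntropy_v₂_le p hch.swap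
  have b₁ := T.entropy_w₁_add_condEntropy_le p
  have b₂ : entropy p T.w₂ + condEntropy p T.y₂ T.w₂ ≤
      entropy p T.y₂ + condEntropy p T.w₂ T.y₂ := T.swap.entropy_w₁_add_condEntropy_le p
  have c₁ := T.entropy_w₁_add_condEntropy_le_condEntropy_v₁ p
  have c₂ : entropy p T.w₂ + condEntropy p T.y₂ T.w₂ ≤
      condEntropy p T.y₂ T.v₂ + entropy p T.v₂ + condEntropy p T.w₂ T.y₂ :=
    T.swap.entropy_w₁_add_condEntropy_le_condEntropy_v₁ p
  have d₁ := T.entropy_w₁_le p hind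
  have d₂ : entropy p T.w₂ ≤ condEntropy p T.y₁ T.w₁ +
      condEntropy p T.y₂ (fun ω => (T.y₁ ω, T.w₁ ω)) + condEntropy p T.w₂ T.y₂ :=
    T.swap.entropy_w₁_le p hind'
  have f₁ := T.entropy_w₁_le_of_feedback p hind
  have f₂ : entropy p T.w₂ ≤ condEntropy p T.y₂ (fun ω => (T.s₁ ω, T.w₁ ω)) + entropy p T.s₁ +
      condEntropy p T.w₂ T.y₂ := T.swap.entropy_w₁_le_of_feedback p hind'
  have g₁ := T.entropy_v₂_le p hind
  have g₂ : entropy p T.v₁ ≤ condEntropy p T.v₁ T.w₂ + entropy p T.s₁ :=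
    T.swap.entropy_v₂_le p hind'
  have n₁ := condEntropy_nonneg p T.v₂ T.w₁
  have n₂ := condEntropy_nonneg p T.v₁ T.w₂
  have k₁ := T.entropy_y₁_le p q hq
  have k₂ : entropy p T.y₂ ≤ N * entropy q (fun ω => T.y₂ ω.2 ω.1) :=
    T.swap.entropy_y₁_le p q hq
  have l₁ := T.condEntropy_y₁_v₁_le p q hq
  have l₂ : condEntropy p T.y₂ T.v₂ ≤
      N * condEntropy q (fun ω => T.y₂ ω.2 ω.1) (fun ω => T.v₂ ω.2 ω.1) :=
    T.swap.condEntropy_y₁_v₁_le p q hq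
  have m₁ := T.condEntropy_y₁_le p q hq hch
  have m₂ : condEntropy p T.y₂ (fun ω => (T.y₁ ω, T.w₁ ω)) ≤
      N * condEntropy q (fun ω => T.y₂ ω.2 ω.1)
        (fun ω => (T.v₁ ω.2 ω.1, T.v₂ ω.2 ω.1, T.aux₂ ω)) := by
    refine (T.swap.condEntropy_y₁_le p q hq hch.swap).trans_eq ?_
    congr 1
    refine condEntropy_congr q _ (fun ω ω' h => ?_) fun ω ω' h => ?_
    all_goals
      simp only [Prod.mk.injEq] at h ⊢
      exact ⟨h.2.1, h.1, h.2.2⟩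
  have r₁ := T.condEntropy_y₁_feedback_le p q hq
  have r₂ : condEntropy p T.y₂ (fun ω => (T.s₁ ω, T.w₁ ω)) ≤
      N * condEntropy q (fun ω => T.y₂ ω.2 ω.1) (fun ω => (T.x₁ ω.2 ω.1, T.aux₂ ω)) :=
    T.swap.condEntropy_y₁_feedback_le p q hq
  have t₁ := T.condEntropy_y₂_le p q hq
  have t₂ : condEntropy p T.y₁ T.w₁ ≤
      N * condEntropy q (fun ω => T.y₁ ω.2 ω.1) (fun ω => (T.x₁ ω.2 ω.1, T.aux₂ ω)) :=
    T.swap.condEntropy_y₂_le p q hq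
  have hR₁ : (N : ℝ) * ((entropy p T.w₁ - e₁) / N) = entropy p T.w₁ - e₁ :=
    mul_div_cancel₀ _ hN'.ne'
  have hR₂ : (N : ℝ) * ((entropy p T.w₂ - e₂) / N) = entropy p T.w₂ - e₂ :=
    mul_div_cancel₀ _ hN'.ne'
  generalize (entropy p T.w₁ - e₁) / N = R₁ at hR₁ ⊢
  generalize (entropy p T.w₂ - e₂) / N = R₂ at hR₂ ⊢
  simp only [boundsFor, letterLaw, entropy_map, condEntropy_map]
  simp only [y₁, y₂, v₁, v₂, DetIC.out₁, DetIC.out₂] at *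
  -- For instance, the bound on 2R₁ + R₂ sums `b₁`, `d₁`, `c₂`, `g₁` and `a₁`: H(Y₁|W₁), H(Y₂|W₂),
  -- H(V₂) and H(V₂|W₁) all cancel.
  refine ⟨le_min ?_ ?_, ?_, le_min ?_ ?_, ?_, ?_, ?_, ?_, ?_, ?_⟩ <;>
    refine le_of_mul_le_mul_left ?_ hN' <;> simp only [mul_add] <;> linarith

end Bounds

/-- If the pasts of the interference agree for two message pairs, then they do not change, nor do
the inputs of user 1 and user 2, when only the message of the other user is exchanged. -/
theorem exchange {i : Fin N} {ω ω' η : Ω} (h₁ : ∀ j < i, T.v₁ ω j = T.v₁ ω' j)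
    (h₂ : ∀ j < i, T.v₂ ω j = T.v₂ ω' j) (hη₁ : T.w₁ η = T.w₁ ω) (hη₂ : T.w₂ η = T.w₂ ω') :
    ∀ j ≤ i, T.x₁ η j = T.x₁ ω j ∧ T.x₂ η j = T.x₂ ω' j := by
  intro j
  induction j using WellFoundedLT.induction with
  | ind j ih =>
    intro hj
    -- Output 1 under `η` sees the interference of `ω'`, which agrees with that of `ω`; so user 1
    -- receives the same feedback as under `ω`. User 2 is symmetric.
    have hlt : ∀ l < j, T.x₁ η l = T.x₁ ω l ∧ T.x₂ η l = T.x₂ ω' l ∧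
        T.v₁ ω l = T.v₁ ω' l ∧ T.v₂ ω l = T.v₂ ω' l := fun l hl =>
      ⟨(ih l hl (hl.le.trans hj)).1, (ih l hl (hl.le.trans hj)).2, h₁ l (hl.trans_le hj),
        h₂ l (hl.trans_le hj)⟩
    refine ⟨T.causal₁ hη₁ fun l hl => ?_, T.causal₂ hη₂ fun l hl => ?_⟩
    · obtain ⟨a, b, -, d⟩ := hlt l hl
      rw [DetIC.out₁, DetIC.out₁, a, b]
      exact congrArg _ d.symm
    · obtain ⟨a, b, d, -⟩ := hlt l hl
      rw [DetIC.out₂, DetIC.out₂, a, b]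
      exact congrArg _ d

end Transmission

/-! ### Conditional independence of the inputs -/

section Exchange

open Classical in
theorem prob_uniformOfFintype {Ω A : Type*} [Fintype Ω] [Nonempty Ω] (X : Ω → A) (a : A) :
    prob (PMF.uniformOfFintype Ω) X a =
      ((Finset.univ.filter fun ω => X ω = a).card : ℝ) / Fintype.card Ω := by
  rw [prob_eq_sum, ← Finset.sum_filter]
  simp [PMF.uniformOfFintype_apply, div_eq_mul_inv]

/-- For a uniform law, functions of `(i, w)` are conditionally independent given `U` when the fibres
of `U` are stable under the exchange of second components and the exchange leaves the first function
of the first argument and the second function of the second argument unchanged. -/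
theorem prob_mul_prob_of_exchange {ι W₁ W₂ U X₁ X₂ : Type*} [Fintype ι] [Fintype W₁] [Fintype W₂]
    [Nonempty (ι × (W₁ × W₂))] (u : ι × (W₁ × W₂) → U) (x₁ : ι × (W₁ × W₂) → X₁)
    (x₂ : ι × (W₁ × W₂) → X₂) (hx : ∀ ω ω', u ω = u ω' → u (ω.1, (ω.2.1, ω'.2.2)) = u ω ∧
      x₁ (ω.1, (ω.2.1, ω'.2.2)) = x₁ ω ∧ x₂ (ω.1, (ω.2.1, ω'.2.2)) = x₂ ω') (c : U) (a : X₁)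
    (b : X₂) :
    prob (PMF.uniformOfFintype _) (fun ω => (u ω, (x₁ ω, x₂ ω))) (c, (a, b)) *
        prob (PMF.uniformOfFintype _) u c =
      prob (PMF.uniformOfFintype _) (fun ω => (u ω, x₁ ω)) (c, a) *
        prob (PMF.uniformOfFintype _) (fun ω => (u ω, x₂ ω)) (c, b) := by
  classical
  simp only [prob_uniformOfFintype, div_mul_div_comm, ← Nat.cast_mul, ← Finset.card_product]
  congr 2
  -- The products of probabilities count pairs of sample points; this involution, swapping the
  -- second messages, matches the two sets of pairs.
  let φ : (ι × (W₁ × W₂)) × (ι × (W₁ × W₂)) → (ι × (W₁ × W₂)) × (ι × (W₁ × W₂)) :=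
    fun z => ((z.1.1, (z.1.2.1, z.2.2.2)), (z.2.1, (z.2.2.1, z.1.2.2)))
  refine Finset.card_nbij' φ φ ?_ ?_ (fun _ _ => rfl) fun _ _ => rfl
  · rintro ⟨ω, ω'⟩ h
    simp only [Finset.coe_product, Finset.coe_filter, Finset.mem_univ, true_and, Set.mem_prod,
      Set.mem_ofPred_eq, Prod.mk.injEq, φ] at h ⊢
    obtain ⟨⟨h₁, h₂, h₃⟩, h₄⟩ := h
    obtain ⟨k₁, k₂, -⟩ := hx ω ω' (h₁.trans h₄.symm)
    obtain ⟨l₁, -, l₃⟩ := hx ω' ω (h₄.trans h₁.symm)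
    exact ⟨⟨k₁.trans h₁, k₂.trans h₂⟩, l₁.trans h₄, l₃.trans h₃⟩
  · rintro ⟨ω, ω'⟩ h
    simp only [Finset.coe_product, Finset.coe_filter, Finset.mem_univ, true_and, Set.mem_prod,
      Set.mem_ofPred_eq, Prod.mk.injEq, φ] at h ⊢
    obtain ⟨⟨h₁, h₂⟩, h₃, h₄⟩ := h
    obtain ⟨k₁, k₂, k₃⟩ := hx ω ω' (h₁.trans h₃.symm)
    obtain ⟨l₁, -, -⟩ := hx ω' ω (h₃.trans h₁.symm)
    exact ⟨⟨k₁.trans h₁, k₂.trans h₂, k₃.trans h₄⟩, l₁.trans h₃⟩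

variable {X₁ X₂ V₁ V₂ Y₁ Y₂ : Type*} [Fintype X₁] [Fintype X₂] [Fintype V₁] [Fintype V₂]
  [Fintype Y₁] [Fintype Y₂] {ch : DetIC X₁ X₂ V₁ V₂ Y₁ Y₂}

/-- Relabelling the auxiliary alphabets by `Fin n` changes no conditional entropy. -/
theorem mem_outerRegion_of_condIndep {Ω A₁ A₂ : Type*} [Fintype Ω] [Fintype A₁] [Fintype A₂]
    (q : PMF Ω) (u : Ω → A₁ × A₂) (x₁ : Ω → X₁) (x₂ : Ω → X₂)
    (h : ∀ c a b, prob q (fun ω => (u ω, (x₁ ω, x₂ ω))) (c, (a, b)) * prob q u c =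
      prob q (fun ω => (u ω, x₁ ω)) (c, a) * prob q (fun ω => (u ω, x₂ ω)) (c, b))
    {C₁ C₂ : ℝ} {R : ℝ × ℝ}
    (hR : R ∈ boundsFor ch C₁ C₂ (q.map fun ω => (u ω, (x₁ ω, x₂ ω)))) :
    R ∈ outerRegion ch C₁ C₂ := by
  classical
  let e₁ := Fintype.equivFin A₁
  let e₂ := Fintype.equivFin A₂
  let e := e₁.prodCongr e₂
  obtain ⟨k₁, k₂, hk⟩ := exists_map_eq_jointLaw q u x₁ x₂ h
  have hlaw : jointLaw ((q.map u).map e) (fun c => k₁ (e.symm c)) (fun c => k₂ (e.symm c)) =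
      (q.map fun ω => (u ω, (x₁ ω, x₂ ω))).map fun z => ((e₁ z.1.1, e₂ z.1.2), z.2) := by
    rw [hk]
    simp only [jointLaw, PMF.map_bind, PMF.bind_map, PMF.map_comp, Function.comp_def,
      Equiv.symm_apply_apply]
    rfl
  refine ⟨_, _, (q.map u).map e, fun c => k₁ (e.symm c), fun c => k₂ (e.symm c), ?_⟩
  rw [hlaw]
  refine boundsFor_mono ch ?_ ?_ ?_ ?_ ?_ ?_ ?_ hR
  · simp only [PMF.map_comp]
    rfl
  all_goals
    simp only [condEntropy_map]
    refine condEntropy_le_of_factorsThrough q _ fun ω ω' h => ?_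
    simpa using h

/-- The auxiliary variables make the inputs at a random time conditionally independent. -/
theorem Transmission.mem_outerRegion {W₁ W₂ S₁ S₂ : Type*} [Fintype W₁] [Fintype W₂] {N : ℕ}
    (T : Transmission ch (W₁ × W₂) W₁ W₂ S₁ S₂ N) (h₁ : T.w₁ = Prod.fst) (h₂ : T.w₂ = Prod.snd)
    [Nonempty (Fin N × (W₁ × W₂))] {C₁ C₂ : ℝ} {R : ℝ × ℝ}
    (hR : R ∈ boundsFor ch C₁ C₂ (T.letterLaw (PMF.uniformOfFintype _))) :
    R ∈ outerRegion ch C₁ C₂ := by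
  refine mem_outerRegion_of_condIndep (PMF.uniformOfFintype _) (fun ω => (T.aux₁ ω, T.aux₂ ω))
    (fun ω => T.x₁ ω.2 ω.1) (fun ω => T.x₂ ω.2 ω.1) (fun c a b =>
    prob_mul_prob_of_exchange _ _ _ (fun ω ω' h => ?_) c a b) hR
  obtain ⟨i, w⟩ := ω
  obtain ⟨i', w'⟩ := ω'
  simp only [Transmission.aux₁, Transmission.aux₂, Prod.mk.injEq] at h ⊢
  obtain ⟨⟨rfl, k₂⟩, -, k₁⟩ := h
  rw [initialSegment_eq_iff] at k₁ k₂
  have key := T.exchange (η := (w.1, w'.2)) k₁ k₂ (by rw [h₁]) (by rw [h₂])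
  refine ⟨⟨⟨trivial, ?_⟩, trivial, ?_⟩, (key i le_rfl).1, (key i le_rfl).2⟩
  · exact initialSegment_eq_iff.2 fun j hj =>
      (T.v₂_eq (key j (Fin.le_def.2 hj.le)).2).trans (k₂ j hj).symm
  · exact initialSegment_eq_iff.2 fun j hj => T.v₁_eq (key j (Fin.le_def.2 hj.le)).1

end Exchange

/-! ### Codes -/

section Converse

variable {X₁ X₂ V₁ V₂ Y₁ Y₂ : Type*} {ch : DetIC X₁ X₂ V₁ V₂ Y₁ Y₂}

/-- The transmission of independent messages with a code. -/
def Code.transmission {C₁ C₂ : ℝ} {N M₁ M₂ : ℕ} (c : Code X₁ X₂ Y₁ Y₂ C₁ C₂ N M₁ M₂)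
    (ch : DetIC X₁ X₂ V₁ V₂ Y₁ Y₂) :
    Transmission ch (Fin M₁ × Fin M₂) (Fin M₁) (Fin M₂) ((i : Fin N) → Fin (c.m₁ i))
      ((i : Fin N) → Fin (c.m₂ i)) N where
  w₁ := Prod.fst
  w₂ := Prod.snd
  s₁ ω i := c.fb₁ i fun l => (c.output ch ω l.1).1
  s₂ ω i := c.fb₂ i fun l => (c.output ch ω l.1).2
  x₁ ω i := c.enc₁ i ω.1 fun j => c.fb₁ j.1 fun l => (c.output ch ω l.1).1
  x₂ ω i := c.enc₂ i ω.2 fun j => c.fb₂ j.1 fun l => (c.output ch ω l.1).2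
  ext_w := Prod.ext
  causal₁ {i ω ω'} hw hy := by
    rw [hw]
    congr 1
    funext j
    congr 1
    funext l
    have := hy l.1 (lt_trans l.2 j.2)
    rw [Code.output, Code.output]
    exact this
  causal₂ {i ω ω'} hw hy := by
    rw [hw]
    congr 1
    funext j
    congr 1
    funext l
    have := hy l.1 (lt_trans l.2 j.2)
    rw [Code.output, Code.output]
    exact this
  feedback₁ {ω ω'} hw hs := by
    funext i
    rw [hw]
    congr 1
    funext j
    exact congrFun hs j.1
  feedback₂ {ω ω'} hw hs := by
    funext i
    rw [hw]
    congr 1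
    funext j
    exact congrFun hs j.1

theorem Code.transmission_y₁ {C₁ C₂ : ℝ} {N M₁ M₂ : ℕ} (c : Code X₁ X₂ Y₁ Y₂ C₁ C₂ N M₁ M₂)
    (ω : Fin M₁ × Fin M₂) : (c.transmission ch).y₁ ω = fun i => (c.output ch ω i).1 := by
  funext i
  rw [Code.output]
  rfl

theorem Code.transmission_y₂ {C₁ C₂ : ℝ} {N M₁ M₂ : ℕ} (c : Code X₁ X₂ Y₁ Y₂ C₁ C₂ N M₁ M₂)
    (ω : Fin M₁ × Fin M₂) : (c.transmission ch).y₂ ω = fun i => (c.output ch ω i).2 := by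
  funext i
  rw [Code.output]
  rfl

theorem entropy_pi_fin_le {Ω : Type*} [Fintype Ω] {N : ℕ} {m : Fin N → ℕ} {C : ℝ} (p : PMF Ω)
    (s : Ω → (i : Fin N) → Fin (m i)) (hm : (∏ i, (m i : ℝ)) ≤ (2 : ℝ) ^ ((N : ℝ) * C)) :
    entropy p s ≤ N * C := by
  obtain ⟨ω, -⟩ := p.support_nonempty
  refine (entropy_le_logb_card p s).trans ?_
  have hpos : (0 : ℝ) < ∏ i, (m i : ℝ) :=
    Finset.prod_pos fun i _ => Nat.cast_pos.2 (Fin.pos (s ω i))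
  rw [Fintype.card_pi, Nat.cast_prod]
  simp only [Fintype.card_fin]
  rwa [Real.logb_le_iff_le_rpow one_lt_two hpos]

/-- The joint entropy is the sum of the two maximal marginal entropies, so subadditivity forces
equality everywhere. -/
theorem entropy_fst_snd_uniform {A B : Type*} [Fintype A] [Fintype B] [Nonempty A] [Nonempty B] :
    entropy (PMF.uniformOfFintype (A × B)) Prod.fst = Real.logb 2 (Fintype.card A) ∧
    entropy (PMF.uniformOfFintype (A × B)) Prod.snd = Real.logb 2 (Fintype.card B) ∧
    entropy (PMF.uniformOfFintype (A × B)) Prod.fst +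
      entropy (PMF.uniformOfFintype (A × B)) Prod.snd =
        entropy (PMF.uniformOfFintype (A × B)) fun ω => (ω.1, ω.2) := by
  have h1 := entropy_le_logb_card (PMF.uniformOfFintype (A × B)) Prod.fst
  have h2 := entropy_le_logb_card (PMF.uniformOfFintype (A × B)) Prod.snd
  have h3 := entropy_pair_le (PMF.uniformOfFintype (A × B)) Prod.fst Prod.snd
  have h4 : entropy (PMF.uniformOfFintype (A × B)) (fun ω => (ω.1, ω.2)) =
      Real.logb 2 (Fintype.card A) + Real.logb 2 (Fintype.card B) := by
    rw [← Real.logb_mul (Nat.cast_ne_zero.2 Fintype.card_ne_zero)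
      (Nat.cast_ne_zero.2 Fintype.card_ne_zero), ← Nat.cast_mul, ← Fintype.card_prod]
    exact entropy_uniform
  refine ⟨?_, ?_, ?_⟩ <;> linarith

variable [Fintype X₁] [Fintype X₂] [Fintype V₁] [Fintype V₂] [Fintype Y₁] [Fintype Y₂]

/-- The converse for a single code: its rates, reduced by the equivocation that Fano's inequality
allows, lie in the outer region. -/
theorem Code.mem_outerRegion (hch : ch.Resolves) {C₁ C₂ : ℝ} {N M₁ M₂ : ℕ} (hN : 0 < N)
    (hM₁ : 0 < M₁) (hM₂ : 0 < M₂) (c : Code X₁ X₂ Y₁ Y₂ C₁ C₂ N M₁ M₂) :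
    ((Real.logb 2 M₁ - (1 + c.err₁ ch * Real.logb 2 M₁)) / N,
      (Real.logb 2 M₂ - (1 + c.err₂ ch * Real.logb 2 M₂)) / N) ∈ outerRegion ch C₁ C₂ := by
  have : Nonempty (Fin N) := ⟨⟨0, hN⟩⟩
  have : Nonempty (Fin M₁) := ⟨⟨0, hM₁⟩⟩
  have : Nonempty (Fin M₂) := ⟨⟨0, hM₂⟩⟩
  let T := c.transmission ch
  refine T.mem_outerRegion rfl rfl ?_
  obtain ⟨h₁, h₂, hind⟩ := entropy_fst_snd_uniform (A := Fin M₁) (B := Fin M₂)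
  rw [Fintype.card_fin] at h₁ h₂
  rw [← h₁, ← h₂]
  refine T.mem_boundsFor (PMF.uniformOfFintype _) (PMF.uniformOfFintype _) (fun i ω => ?_) hN hch
    hind (entropy_pi_fin_le _ _ c.rate₁) (entropy_pi_fin_le _ _ c.rate₂) ?_ ?_
  · have : (N : ℝ) ≠ 0 := Nat.cast_ne_zero.2 hN.ne'
    simp [PMF.uniformOfFintype_apply]
    field_simp
  · refine (condEntropy_le_fano _ T.w₁ T.y₁ c.dec₁).trans_eq ?_
    have hw : T.w₁ = Prod.fst := rfl
    have hy : T.y₁ = fun ω i => (c.output ch ω i).1 := funext c.transmission_y₁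
    rw [h₁, Fintype.card_fin]
    simp [Finset.sum_ite, hw, hy, PMF.uniformOfFintype_apply, Code.err₁, div_eq_mul_inv]
  · refine (condEntropy_le_fano _ T.w₂ T.y₂ c.dec₂).trans_eq ?_
    have hw : T.w₂ = Prod.snd := rfl
    have hy : T.y₂ = fun ω i => (c.output ch ω i).2 := funext c.transmission_y₂
    rw [h₂, Fintype.card_fin]
    simp [Finset.sum_ite, hw, hy, PMF.uniformOfFintype_apply, Code.err₂, div_eq_mul_inv]

theorem numMessages_pos (N : ℕ) {R : ℝ} (hR : 0 ≤ R) : 0 < numMessages N R :=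
  Nat.floor_pos.2 (Real.one_le_rpow one_le_two (by positivity))

theorem tendsto_logb_numMessages_div {R : ℝ} (hR : 0 ≤ R) :
    Filter.Tendsto (fun N : ℕ => Real.logb 2 (numMessages N R) / N) Filter.atTop (nhds R) := by
  have hinv : Filter.Tendsto (fun N : ℕ => R - 1 / (N : ℝ)) Filter.atTop (nhds R) := by
    simpa using tendsto_const_nhds.sub (tendsto_one_div_atTop_nhds_zero_nat (𝕜 := ℝ))
  refine tendsto_of_tendsto_of_tendsto_of_le_of_le' hinv tendsto_const_nhds ?_ ?_
  all_goals
    filter_upwards [Filter.eventually_gt_atTop 0] with N hN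
    have hN' : (0 : ℝ) < N := Nat.cast_pos.2 hN
    have hpos : (0 : ℝ) < numMessages N R := Nat.cast_pos.2 (numMessages_pos N hR)
  · rw [le_div_iff₀ hN', sub_mul, one_div, inv_mul_cancel₀ hN'.ne',
      Real.le_logb_iff_rpow_le one_lt_two hpos, mul_comm R, Real.rpow_sub two_pos, Real.rpow_one]
    -- A number with floor at least 1 is less than twice its floor, so rounding costs at most one
    -- bit per block.
    have h1 := Nat.lt_floor_add_one ((2 : ℝ) ^ ((N : ℝ) * R))
    have h2 : (1 : ℝ) ≤ numMessages N R := Nat.one_le_cast.2 (numMessages_pos N hR)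
    rw [numMessages] at h2 ⊢
    linarith
  · rw [div_le_iff₀ hN', Real.logb_le_iff_le_rpow one_lt_two hpos, mul_comm R]
    exact Nat.floor_le (by positivity)

/-- Per channel use the Fano correction is 1/N plus the error probability times a convergent rate,
hence vanishes. -/
theorem tendsto_rate {R : ℝ} (hR : 0 ≤ R) {err : ℕ → ℝ}
    (herr : Filter.Tendsto err Filter.atTop (nhds 0)) :
    Filter.Tendsto (fun N : ℕ => (Real.logb 2 (numMessages N R) -
      (1 + err N * Real.logb 2 (numMessages N R))) / N) Filter.atTop (nhds R) := by
  have h1 := tendsto_logb_numMessages_div hR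
  have h2 := (h1.sub (tendsto_one_div_atTop_nhds_zero_nat (𝕜 := ℝ))).sub (herr.mul h1)
  rw [sub_zero, zero_mul, sub_zero] at h2
  refine h2.congr fun N => ?_
  ring

theorem Achievable.mem_outerRegion (hch : ch.Resolves) {C₁ C₂ : ℝ} {R : ℝ × ℝ}
    (hR : Achievable ch C₁ C₂ R) : R ∈ outerRegion ch C₁ C₂ := by
  obtain ⟨h₁, h₂, c, he₁, he₂⟩ := hR
  refine (isClosed_outerRegion ch C₁ C₂).mem_of_tendsto
    ((tendsto_rate h₁ he₁).prodMk_nhds (tendsto_rate h₂ he₂)) ?_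
  filter_upwards [Filter.eventually_gt_atTop 0] with N hN
  exact (c N).mem_outerRegion hch hN (numMessages_pos N h₁) (numMessages_pos N h₂)

end Converse

end FeedbackIC

theorem theorem2 {X₁ X₂ V₁ V₂ Y₁ Y₂ : Type*} [Fintype X₁] [Fintype X₂] [Fintype V₁] [Fintype V₂]
    [Fintype Y₁] [Fintype Y₂] (ch : FeedbackIC.DetIC X₁ X₂ V₁ V₂ Y₁ Y₂)
    (hch : ch.IsElGamalCosta) (C₁ C₂ : ℝ) (hC₁ : 0 ≤ C₁) (hC₂ : 0 ≤ C₂) :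
    FeedbackIC.capacityRegion ch C₁ C₂ ⊆ FeedbackIC.outerRegion ch C₁ C₂ :=
  closure_minimal (fun _ hR => FeedbackIC.Achievable.mem_outerRegion hch.resolves hR)
    (FeedbackIC.isClosed_outerRegion ch C₁ C₂)
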